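/- Let $N=3M-2$ with integers $M\ge 2$, and put $M_1=(N-4)/3$, $M_2=(N+2)/3$, $\eta_\alpha=e^{2\pi i\alpha/N}$ for $\alpha=1,\dots,N$. On $(\mathbb{C}^3)^{\otimes N}$, with colors b, r, g, let $e_\alpha^{\sigma\tau}$ replace color $\tau$ by color $\sigma$ at site $\alpha$ (and annihilate the other colors there), let $\boldsymbol J_\alpha=\frac12\sum_{\sigma\tau}e_\alpha^{\sigma\tau}\boldsymbol\lambda_{\sigma\tau}$ with the eight Gell-Mann matrices $\boldsymbol\lambda$, and let $$H=\Bigl(\frac{2\pi}{N}\Bigr)^2\sum_{\alpha<\beta}\frac{\boldsymbol J_\alpha\cdot\boldsymbol J_\beta}{|\eta_\alpha-\eta_\beta|^2}$$ be the SU(3) Haldane–Shastry Hamiltonian. A wave function $\Psi[z_1,\dots,z_{M_1};w_1,\dots,w_{M_2}]$ defines the state $|\Psi\rangle=\sum_{\{z_i,w_k\}}\Psi[z_i;w_k]\,e^{bg}_{z_1}\cdots e^{bg}_{z_{M_1}}e^{rg}_{w_1}\cdots e^{rg}_{w_{M_2}}|0_g\rangle$, where $|0_g\rangle$ has color g on every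 site and the sum runs over all ways to place the blue particles ($z_i$) and the red particles ($w_k$) on distinct sites. Let $$\Psi_0=\prod_{i<j}(z_i-z_j)^2\prod_{k<l}(w_k-w_l)^2\prod_{i,k}(z_i-w_k)\prod_i z_i\prod_k w_k,$$ $$\Psi_{mn}=\frac1{N^2}\sum_{\gamma,\delta=1}^N\bar\eta_\gamma^{\,m}\,\bar\eta_\delta^{\,n}\prod_{i=1}^{M_1}(\eta_\gamma-z_i)(\eta_\delta-z_i)\,\Psi_0 .$$ Let $0\le n\le m\le M_1$ and $\ell_{\rm m}=\min(M_1-m,n)$. Then the following hold. 1. $H$ acts triangularly on the momentum states: $$\begin{aligned}H|\Psi_{mn}\rangle=&-\frac{\pi^2}{18}\Bigl(N-\frac{17}{N}+\frac{52}{N^2}\Bigr)|\Psi_{mn}\rangle+\frac{3\pi^2}{N^2}\Bigl[(M_1-m)m+(M_1-n)n-\frac23(m-n)\Bigr]|\Psi_{mn}\rangle\\&-\frac{4\pi^2}{N^2}\sum_{\ell=1}^{\ell_{\rm m}}(m-n+2\ell)\,|\Psi_{m+\ell,n-\ell}\rangle .\end{aligned}$$ 2. Let $a_0^{mn}=1$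 and $$a_\ell^{mn}=\frac{(\ell-\frac53)(m-n+\ell-1)(m-n+2\ell)}{\ell\,(m-n+\ell+\frac23)(m-n+2\ell-2)}\,a_{\ell-1}^{mn}\qquad(\ell\ge1),$$ with $a_1^{mm}=-\frac45$. Then $\Phi_{mn}=\sum_{\ell=0}^{\ell_{\rm m}}a_\ell^{mn}\Psi_{m+\ell,n-\ell}$ gives a nonzero state with $H|\Phi_{mn}\rangle=E_{mn}|\Phi_{mn}\rangle$, where $$E_{mn}=-\frac{\pi^2}{18}\Bigl(N-\frac{17}{N}+\frac{52}{N^2}\Bigr)+\frac{3\pi^2}{N^2}\Bigl[(M_1-m)m+(M_1-n)n-\frac23(m-n)\Bigr].$$ Conversely, if $a_0=1$ and $\sum_{\ell=0}^{\ell_{\rm m}}a_\ell|\Psi_{m+\ell,n-\ell}\rangle$ satisfies the eigenvalue equation of $H$ with some $E\in\mathbb{C}$, then $E=E_{mn}$ and $a_\ell=a_\ell^{mn}$ for all $0\le\ell\le\ell_{\rm m}$. 3. With $p_m=\frac43\pi-\frac{2\pi}{N}(m+1)$, $p_n=\frac43\pi-\frac{2\pi}{N}(n+\frac13)$, $\epsilon(p)=\frac34\bigl(\frac{\pi^2}{9}-(p-\pi)^2\bigr)$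 and $E_0=-\frac{\pi^2}{18}\bigl(N+\frac7N\bigr)$, $$E_{mn}=E_0+\frac49\frac{\pi^2}{N^2}+\epsilon(p_m)+\epsilon(p_n),\qquad p_n-p_m=\frac{2\pi}{N}\Bigl(\frac23+(m-n)\Bigr).$$ -/

import Mathlib

namespace HaldaneShastry

noncomputable section

/-- The lattice site `η_α = exp(2πi α / N)`. The label `α = N` is identified with `α = 0`. -/
def site (N : ℕ) (α : Fin N) : ℂ :=
  Complex.exp (2 * Real.pi * Complex.I * ((α : ℕ) : ℂ) / (N : ℂ))

/-- The colors blue, red, green, in the order used for the Gell-Mann matrices. -/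
abbrev Color := Fin 3

abbrev blue : Color := 0
abbrev red : Color := 1
abbrev green : Color := 2

/-- States of a chain of `N` SU(3) spins, given by their amplitudes in the basis of
color configurations (one particle on every site). -/
abbrev State (N : ℕ) := (Fin N → Color) → ℂ

/-- The colorflip operator `e_α^{στ}`: it annihilates a particle of color `τ` at site `α` and
creates a particle of color `σ` there, so it maps the basis configuration `c` to
`c` with `c α` replaced by `σ` if `c α = τ`, and to zero otherwise. -/
def colorFlip {N : ℕ} (α : Fin N) (σ τ : Color) : Module.End ℂ (State N) where
  toFun ψ := fun c => if c α = σ then ψ (Function.update c α τ) else 0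
  map_add' ψ φ := by
    funext c
    by_cases h : c α = σ <;> simp [h]
  map_smul' r ψ := by
    funext c
    by_cases h : c α = σ <;> simp [h]

/-- The eight Gell-Mann matrices `λ^1, …, λ^8` (indexed from zero). -/
def gellMann : Fin 8 → Matrix Color Color ℂ :=
  ![!![0, 1, 0; 1, 0, 0; 0, 0, 0],
    !![0, -Complex.I, 0; Complex.I, 0, 0; 0, 0, 0],
    !![1, 0, 0; 0, -1, 0; 0, 0, 0],
    !![0, 0, 1; 0, 0, 0; 1, 0, 0],
    !![0, 0, -Complex.I; 0, 0, 0; Complex.I, 0, 0],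
    !![0, 0, 0; 0, 0, 1; 0, 1, 0],
    !![0, 0, 0; 0, 0, -Complex.I; 0, Complex.I, 0],
    (((1 / Real.sqrt 3 : ℝ) : ℂ)) • !![1, 0, 0; 0, 1, 0; 0, 0, -2]]

/-- The component `J_α^a = (1/2) ∑_{στ} λ^a_{στ} e_α^{στ}` of the SU(3) spin at site `α`. -/
def spin {N : ℕ} (α : Fin N) (a : Fin 8) : Module.End ℂ (State N) :=
  (1 / 2 : ℂ) • ∑ σ : Color, ∑ τ : Color, gellMann a σ τ • colorFlip α σ τ

/-- The SU(3) Haldane–Shastry Hamiltonian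
`(2π/N)² ∑_{α<β} J_α · J_β / |η_α - η_β|²`. -/
def hamiltonian (N : ℕ) : Module.End ℂ (State N) :=
  (((2 * Real.pi / N) ^ 2 : ℝ) : ℂ) •
    ∑ α : Fin N, ∑ β ∈ Finset.Ioi α,
      ((1 / ‖site N α - site N β‖ ^ 2 : ℝ) : ℂ) • ∑ a : Fin 8, spin α a * spin β a

/-- The reference state: a green particle on every site. -/
def referenceState (N : ℕ) : State N :=
  Pi.single (fun _ => green) 1

/-- Wave functions `Ψ[z_i; w_k]` of `M₁` blue and `M₂` red coordinates. -/
abbrev WaveFunction (M₁ M₂ : ℕ) := (Fin M₁ → ℂ) → (Fin M₂ → ℂ) → ℂ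

open Classical in
/-- The state `∑ Ψ[z_i; w_k] e_{z_1}^{bg} ⋯ e_{z_{M₁}}^{bg} e_{w_1}^{rg} ⋯ e_{w_{M₂}}^{rg} |0_g⟩`,
where the sum is over all ways to place the blue and red particles on distinct sites.
The particles of one color are listed in increasing order of their sites, so that every
placement occurs once. -/
def ket (N : ℕ) {M₁ M₂ : ℕ} (Ψ : WaveFunction M₁ M₂) : State N :=
  ∑ z : Fin M₁ → Fin N, ∑ w : Fin M₂ → Fin N,
    if StrictMono z ∧ StrictMono w ∧ ∀ i k, z i ≠ w k then
      Ψ (fun i => site N (z i)) (fun k => site N (w k)) •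
        ((List.ofFn fun i => colorFlip (z i) blue green).prod *
          (List.ofFn fun k => colorFlip (w k) red green).prod) (referenceState N)
    else 0

/-- The Gutzwiller wave function `Ψ₀`. -/
def psiZero (M₁ M₂ : ℕ) : WaveFunction M₁ M₂ := fun z w =>
  (∏ i, ∏ j ∈ Finset.Ioi i, (z i - z j) ^ 2) *
  (∏ k, ∏ l ∈ Finset.Ioi k, (w k - w l) ^ 2) *
  (∏ i, ∏ k, (z i - w k)) * (∏ i, z i) * ∏ k, w k

/-- Two colorons localized at the sites `γ` and `δ`. -/
def psiLocalized (N M₁ M₂ : ℕ) (γ δ : Fin N) : WaveFunction M₁ M₂ := fun z w =>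
  (∏ i, (site N γ - z i) * (site N δ - z i)) * psiZero M₁ M₂ z w

/-- The two-coloron momentum states `Ψ_mn`. -/
def psiMomentum (N M₁ M₂ m n : ℕ) : WaveFunction M₁ M₂ := fun z w =>
  1 / (N : ℂ) ^ 2 * ∑ γ : Fin N, ∑ δ : Fin N,
    star (site N γ) ^ m * star (site N δ) ^ n * psiLocalized N M₁ M₂ γ δ z w

/-- `ℓ_m = min(M₁ - m, n)`, for `m ≤ M₁`. -/
def ellMax (M₁ m n : ℕ) : ℕ := min (M₁ - m) n

/-- The combination `∑_{ℓ=0}^{ℓ_m} a_ℓ Ψ_{m+ℓ,n-ℓ}`. -/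
def psiCombination (N M₁ M₂ m n : ℕ) (a : ℕ → ℂ) : WaveFunction M₁ M₂ := fun z w =>
  ∑ ℓ ∈ Finset.range (ellMax M₁ m n + 1), a ℓ * psiMomentum N M₁ M₂ (m + ℓ) (n - ℓ) z w

/-- The coefficients `a_ℓ^{mn}` for `n ≤ m`. The recursion formula reads `0 / 0` only for
`m = n` and `ℓ = 1`, where the value is `-4/5`. -/
def coeff (m n : ℕ) : ℕ → ℝ
  | 0 => 1
  | ℓ + 1 =>
    if m = n ∧ ℓ + 1 = 1 then -4 / 5
    else
      (((ℓ + 1 : ℕ) : ℝ) - 5 / 3) * ((m : ℝ) - n + ((ℓ + 1 : ℕ) : ℝ) - 1) *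
          ((m : ℝ) - n + 2 * ((ℓ + 1 : ℕ) : ℝ)) /
        (((ℓ + 1 : ℕ) : ℝ) * ((m : ℝ) - n + ((ℓ + 1 : ℕ) : ℝ) + 2 / 3) *
          ((m : ℝ) - n + 2 * ((ℓ + 1 : ℕ) : ℝ) - 2)) * coeff m n ℓ

/-- The states `Φ_mn`. -/
def phi (N M₁ M₂ m n : ℕ) : WaveFunction M₁ M₂ :=
  psiCombination N M₁ M₂ m n fun ℓ => (coeff m n ℓ : ℂ)

/-- The two-coloron energies `E_mn`. -/
def energy (N M₁ m n : ℕ) : ℝ :=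
  -(Real.pi ^ 2 / 18) * ((N : ℝ) - 17 / N + 52 / (N : ℝ) ^ 2) +
    3 * Real.pi ^ 2 / (N : ℝ) ^ 2 *
      (((M₁ : ℝ) - m) * m + ((M₁ : ℝ) - n) * n - 2 / 3 * ((m : ℝ) - n))

/-- `E₀ = -(π²/18) (N + 7/N)`. -/
def energyZero (N : ℕ) : ℝ := -(Real.pi ^ 2 / 18) * ((N : ℝ) + 7 / N)

/-- The one-coloron dispersion relation `ε(p)`. -/
def dispersion (p : ℝ) : ℝ := 3 / 4 * (Real.pi ^ 2 / 9 - (p - Real.pi) ^ 2)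

/-- The single-coloron momentum `p_m` (belonging to the larger quantum number `m`). -/
def momentumM (N m : ℕ) : ℝ := 4 / 3 * Real.pi - 2 * Real.pi / N * ((m : ℝ) + 1)

/-- The single-coloron momentum `p_n` (belonging to the smaller quantum number `n`). -/
def momentumN (N n : ℕ) : ℝ := 4 / 3 * Real.pi - 2 * Real.pi / N * ((n : ℝ) + 1 / 3)

end

end HaldaneShastry

open HaldaneShastry

/-!
The proof turns the spin exchange into a differential operator on wave functions and diagonalizes a
triangular matrix.

The completeness relation of the Gell-Mann matrices gives `J_α · J_β = (P_{αβ} - 1/3) / 2`, so that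
the Hamiltonian moves colored particles to green sites, exchanges blue with red particles, and acts
diagonally otherwise. The wave functions `Ψ_mn` vanish when two coordinates coincide, and hence the
particles may be moved to all sites of the lattice (`hamiltonian_ket_apply_config`). They are
polynomials of degree less than `N` in each coordinate, on which such hopping is the operator
`(N² - 1) / 12 - (N - 1) / 2 x ∂ + x² ∂² / 2` (`sum_coupling_mul_eval`). The exchange of a blue
particle at `z_i` with the red particles at `w_k` multiplies `Ψ₀` by a ratio of products of
differences; the sum over `k` is a sum of residues in `w_k`, and equals minus the residue at `z_i`,
which is again a second order differential operator in `z_i` (`sum_residues`,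
`sum_coupling_mul_exchange`). In the sum of all terms the identity
`x² / ((x - y) (x - t)) + cyc = 1` reduces the three-particle terms to constants
(`sum_blueTerm_add_sum_redTerm`). What remains is an operator on the cofactor of `Ψ₀` that involves
only the blue coordinates.

With `c_m` the coefficients of `∏_i (X - z_i)`, the Fourier transform in `γ`, `δ` gives
`Ψ_mn = c_m c_n Ψ₀` (`psiMomentum_eq`). The first order part of the remaining operator is diagonal
on these products; the second order part is `2 ∑_i z_i² E_i[m] E_i[n]` with the coefficients of
`E_i = ∏_{j ≠ i} (X - z_j)`, and the relation `z_i E_i = X E_i - ∏_j (X - z_j)` yields a recursion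
that makes it triangular (`sum_sq_mul_coeff_mul_coeff`). This proves the triangular action
(`hamiltonian_ket_psiMomentum`).

The states `Ψ_{m+ℓ,n-ℓ}` are linearly independent
(`eq_zero_of_sum_smul_ket_psiMomentum_eq_zero`): a vanishing combination is a polynomial in the
blue coordinates, of degree at most two in each of them, which vanishes when the coordinates lie in
disjoint triples of sites, hence everywhere, and choosing `∏_i (X - z_i) = X^M₁ + X^(m+ℓ) + X^(n-ℓ)`
isolates one coefficient. The eigenvalue equation may therefore be compared coefficient by
coefficient. It determines `E` and then each `a_ℓ` from the sum of the preceding ones, and the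
partial sums of the `a_ℓ^{mn}` have a closed form (`coeff_succ_mul`).
-/

namespace HaldaneShastry

/-! ### The spin exchange -/

/-- Completeness relation of the Gell-Mann matrices. -/
theorem sum_gellMann_mul_gellMann (σ τ σ' τ' : Color) :
    ∑ a, gellMann a σ τ * gellMann a σ' τ' =
      2 * ((if σ = τ' ∧ τ = σ' then 1 else 0) - (if σ = τ ∧ σ' = τ' then 1 else 0) / 3) := by
  have h3 : ((Real.sqrt 3 : ℝ) : ℂ)⁻¹ * ((Real.sqrt 3 : ℝ) : ℂ)⁻¹ = 1 / 3 := by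
    rw [← mul_inv, ← Complex.ofReal_mul, Real.mul_self_sqrt (by norm_num)]
    norm_num
  fin_cases σ <;> fin_cases τ <;> fin_cases σ' <;> fin_cases τ' <;>
    simp [gellMann, Fin.sum_univ_eight] <;> 
    first
      | done
      | (ring_nf; done)
      | linear_combination h3
      | linear_combination (-2 : ℂ) * h3
      | linear_combination (2 : ℂ) * h3
      | linear_combination (4 : ℂ) * h3

theorem spin_apply {N : ℕ} (α : Fin N) (a : Fin 8) (ψ : State N) (c : Fin N → Color) :
    spin α a ψ c = 1 / 2 * ∑ τ, gellMann a (c α) τ * ψ (Function.update c α τ) := by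
  have h (σ τ : Color) : colorFlip α σ τ ψ c =
      if c α = σ then ψ (Function.update c α τ) else 0 := rfl
  simp only [spin, LinearMap.smul_apply, LinearMap.sum_apply, Pi.smul_apply, Finset.sum_apply,
    smul_eq_mul, h, mul_ite, mul_zero]
  rw [Finset.sum_comm]
  simp

/-- `J_α · J_β = (P_{αβ} - 1/3) / 2`, where `P_{αβ}` exchanges the spins at `α` and `β`. -/
theorem sum_spin_mul_spin_apply {N : ℕ} {α β : Fin N} (h : α ≠ β) (ψ : State N)
    (c : Fin N → Color) :
    (∑ a, spin α a * spin β a) ψ c = 1 / 2 * (ψ (c ∘ Equiv.swap α β) - ψ c / 3) := by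
  have key (τ τ' : Color) :
      ∑ a, gellMann a (c α) τ *
          (gellMann a (c β) τ' * ψ (Function.update (Function.update c α τ) β τ'))
        = (if τ' = c α then if τ = c β then 2 * ψ (c ∘ Equiv.swap α β) else 0 else 0) -
          (if τ' = c β then if τ = c α then 2 / 3 * ψ c else 0 else 0) := by
    simp only [← mul_assoc]
    rw [← Finset.sum_mul, sum_gellMann_mul_gellMann]
    have e1 : Function.update (Function.update c α (c β)) β (c α) = c ∘ Equiv.swap α β := by
      ext x
      by_cases hx : x = β
      · subst hx; simp
      · by_cases hx' : x = α
        · subst hx'; simp [hx]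
        · simp [hx, hx', Equiv.swap_apply_of_ne_of_ne hx' hx]
    have e2 : Function.update (Function.update c α (c α)) β (c β) = c := by simp
    have s1 : (if c α = τ' ∧ τ = c β then (1 : ℂ) else 0) *
        ψ (Function.update (Function.update c α τ) β τ') =
        if τ' = c α then if τ = c β then ψ (c ∘ Equiv.swap α β) else 0 else 0 := by
      by_cases h1 : τ' = c α <;> by_cases h2 : τ = c β <;> simp [h1, h2, e1, eq_comm]
    have s2 : (if c α = τ ∧ c β = τ' then (1 : ℂ) else 0) *
        ψ (Function.update (Function.update c α τ) β τ') =
        if τ' = c β then if τ = c α then ψ c else 0 else 0 := by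
      by_cases h1 : τ' = c β <;> by_cases h2 : τ = c α <;> simp [h1, h2, eq_comm]
    calc _ = 2 * ((if c α = τ' ∧ τ = c β then (1 : ℂ) else 0) *
          ψ (Function.update (Function.update c α τ) β τ')) -
          2 / 3 * ((if c α = τ ∧ c β = τ' then (1 : ℂ) else 0) *
          ψ (Function.update (Function.update c α τ) β τ')) := by ring
      _ = _ := by rw [s1, s2]; simp only [mul_ite, mul_zero]
  simp only [LinearMap.sum_apply, Finset.sum_apply, Module.End.mul_apply, spin_apply,
    Function.update_of_ne h.symm, Finset.mul_sum]
  have r (a : Fin 8) (τ τ' : Color) :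
      1 / 2 * (gellMann a (c α) τ * (1 / 2 * (gellMann a (c β) τ' *
        ψ (Function.update (Function.update c α τ) β τ')))) =
      1 / 4 * (gellMann a (c α) τ * (gellMann a (c β) τ' *
        ψ (Function.update (Function.update c α τ) β τ'))) := by ring
  simp only [r]
  rw [Finset.sum_comm]
  have : ∀ τ : Color, ∑ a, ∑ τ' : Color, 1 / 4 * (gellMann a (c α) τ * (gellMann a (c β) τ' *
        ψ (Function.update (Function.update c α τ) β τ'))) =
      1 / 4 * ∑ τ' : Color,
        ((if τ' = c α then if τ = c β then 2 * ψ (c ∘ Equiv.swap α β) else 0 else 0) -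
          (if τ' = c β then if τ = c α then 2 / 3 * ψ c else 0 else 0)) := by
    intro τ
    rw [Finset.sum_comm, Finset.mul_sum]
    exact Finset.sum_congr rfl fun τ' _ => by rw [← Finset.mul_sum, key]
  simp only [this]
  rw [← Finset.mul_sum]
  simp only [Finset.sum_sub_distrib, Finset.sum_ite_eq', Finset.mem_univ, if_true]
  ring

/-- The coupling `1 / |η_α - η_β|²`; it vanishes for `α = β`. -/
noncomputable def coupling {N : ℕ} (α β : Fin N) : ℂ := ((1 / ‖site N α - site N β‖ ^ 2 : ℝ) : ℂ)

theorem coupling_self {N : ℕ} (α : Fin N) : coupling α α = 0 := by simp [coupling]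

theorem coupling_comm {N : ℕ} (α β : Fin N) : coupling α β = coupling β α := by
  simp [coupling, norm_sub_rev]

theorem sum_Ioi_eq_half_sum {N : ℕ} (f : Fin N → Fin N → ℂ) (h0 : ∀ α, f α α = 0)
    (hf : ∀ α β, f α β = f β α) :
    ∑ α, ∑ β ∈ Finset.Ioi α, f α β = 1 / 2 * ∑ α, ∑ β, f α β := by
  have h1 : ∀ α, ∑ β, f α β = ∑ β ∈ Finset.Ioi α, f α β + ∑ β ∈ Finset.Iio α, f α β := by
    intro α
    rw [← Finset.sum_filter_add_sum_filter_not _ (fun β => α < β)]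
    congr 1
    · exact Finset.sum_congr (by ext; simp) fun _ _ => rfl
    · refine (Finset.sum_subset (by intro x; simp; exact le_of_lt) ?_).symm
      intro x hx hx'
      have : x = α := le_antisymm (by simpa using hx) (by simpa using hx')
      rw [this, h0]
  have h2 : ∑ α, ∑ β ∈ Finset.Iio α, f α β = ∑ α, ∑ β ∈ Finset.Ioi α, f α β := by
    rw [Finset.sum_comm' (t' := Finset.univ) (s' := fun β => Finset.Ioi β) (by simp)]
    exact Finset.sum_congr rfl fun _ _ => Finset.sum_congr rfl fun _ _ => hf _ _
  simp only [h1, Finset.sum_add_distrib, h2]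
  ring

/-- The factor `1/2` of the spin exchange and the one from summing over ordered pairs turn
`(2π/N)²` into `π²/N²`. -/
theorem hamiltonian_apply (N : ℕ) (ψ : State N) (c : Fin N → Color) :
    hamiltonian N ψ c = ((Real.pi : ℂ) ^ 2 / (N : ℂ) ^ 2) *
      (∑ α, ∑ β, coupling α β * ψ (c ∘ Equiv.swap α β) -
        (∑ α, ∑ β : Fin N, coupling α β) / 3 * ψ c) := by
  have h1 : hamiltonian N ψ c = (((2 * Real.pi / N) ^ 2 : ℝ) : ℂ) *
      ∑ α : Fin N, ∑ β ∈ Finset.Ioi α,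
        coupling α β * (1 / 2 * (ψ (c ∘ Equiv.swap α β) - ψ c / 3)) := by
    rw [hamiltonian, LinearMap.smul_apply, Pi.smul_apply, smul_eq_mul, LinearMap.sum_apply,
      Finset.sum_apply]
    congr 1
    refine Finset.sum_congr rfl fun α _ => ?_
    rw [LinearMap.sum_apply, Finset.sum_apply]
    refine Finset.sum_congr rfl fun β hβ => ?_
    rw [LinearMap.smul_apply, Pi.smul_apply, smul_eq_mul,
      sum_spin_mul_spin_apply (ne_of_lt (Finset.mem_Ioi.1 hβ)), coupling]
  rw [h1, sum_Ioi_eq_half_sum]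
  · simp only [mul_sub, Finset.sum_sub_distrib, mul_left_comm _ (1 / 2 : ℂ), ← Finset.mul_sum]
    simp only [← mul_div_assoc, ← Finset.sum_mul, ← Finset.sum_div]
    push_cast
    ring
  · intro α; simp [coupling_self]
  · intro α β; rw [coupling_comm, Equiv.swap_comm]

/-! ### Amplitudes of the states defined by wave functions -/

/-- The configuration with blue particles at the sites `z i`, red particles at the sites `w k`
and green particles elsewhere. -/
def config {N M₁ M₂ : ℕ} (z : Fin M₁ → Fin N) (w : Fin M₂ → Fin N) : Fin N → Color :=
  fun α => if ∃ i, z i = α then blue else if ∃ k, w k = α then red else green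

/-- `z` and `w` place their particles on pairwise distinct sites. -/
structure IsPlacement {N M₁ M₂ : ℕ} (z : Fin M₁ → Fin N) (w : Fin M₂ → Fin N) : Prop where
  inj_left : Function.Injective z
  inj_right : Function.Injective w
  disj : ∀ i k, z i ≠ w k

/-- Wave functions of indistinguishable particles. -/
structure IsSymmetric {M₁ M₂ : ℕ} (Ψ : WaveFunction M₁ M₂) : Prop where
  left : ∀ (σ : Equiv.Perm (Fin M₁)) z w, Ψ (z ∘ σ) w = Ψ z w
  right : ∀ (σ : Equiv.Perm (Fin M₂)) z w, Ψ z (w ∘ σ) = Ψ z w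

section config

variable {N M₁ M₂ : ℕ} {z : Fin M₁ → Fin N} {w : Fin M₂ → Fin N}

theorem config_eq_blue {α : Fin N} : config z w α = blue ↔ ∃ i, z i = α := by
  unfold config; split_ifs with h1 h2 <;> simp_all; decide

theorem config_eq_red (h : IsPlacement z w) {α : Fin N} : config z w α = red ↔ ∃ k, w k = α := by
  have := h.disj
  unfold config; split_ifs with h1 h2
  · obtain ⟨i, rfl⟩ := h1
    simpa [eq_comm] using fun k => this i k
  · simp [h2]
  · simp [h2]; decide

theorem config_eq_green {α : Fin N} :
    config z w α = green ↔ (∀ i, z i ≠ α) ∧ ∀ k, w k ≠ α := by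
  unfold config
  split_ifs with h1 h2
  · exact iff_of_false (by decide) fun h => h1.elim h.1
  · exact iff_of_false (by decide) fun h => h2.elim h.2
  · simp_all

theorem config_left (i : Fin M₁) : config z w (z i) = blue := config_eq_blue.2 ⟨i, rfl⟩

theorem config_right (h : IsPlacement z w) (k : Fin M₂) : config z w (w k) = red :=
  (config_eq_red h).2 ⟨k, rfl⟩

/-- A configuration is determined by its blue and red sites. -/
theorem eq_config (h : IsPlacement z w) {c : Fin N → Color} (hz : ∀ i, c (z i) = blue)
    (hw : ∀ k, c (w k) = red) (hg : ∀ α, (∀ i, z i ≠ α) → (∀ k, w k ≠ α) → c α = green) :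
    c = config z w := by
  funext α
  by_cases h1 : ∃ i, z i = α
  · obtain ⟨i, rfl⟩ := h1; rw [hz, config_left]
  · by_cases h2 : ∃ k, w k = α
    · obtain ⟨k, rfl⟩ := h2; rw [hw, config_right h]
    · push Not at h1 h2
      rw [hg α h1 h2, config_eq_green.2 ⟨h1, h2⟩]

end config

theorem colorFlip_single {N : ℕ} (α : Fin N) (σ : Color) (c : Fin N → Color) :
    colorFlip α σ (c α) (Pi.single c 1) = Pi.single (Function.update c α σ) 1 := by
  funext d
  change (if d α = σ then (Pi.single c 1 : State N) (Function.update d α (c α)) else 0) = _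
  simp only [Pi.single_apply]
  by_cases h : d = Function.update c α σ
  · subst h; simp
  · rw [if_neg h]
    split_ifs with h1 h2
    · refine absurd ?_ h
      rw [← h2, ← h1]; simp
    · rfl
    · rfl

theorem prod_colorFlip_single {N M : ℕ} (σ : Color) (z : Fin M → Fin N)
    (hz : Function.Injective z) (c : Fin N → Color) (hc : ∀ i, c (z i) = green) :
    (List.ofFn fun i => colorFlip (z i) σ green).prod (Pi.single c 1) =
      Pi.single (fun α => if ∃ i, z i = α then σ else c α) 1 := by
  induction M with
  | zero => simp
  | succ M ih =>
    have h0 : ¬ ∃ i : Fin M, z i.succ = z 0 := by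
      rintro ⟨i, hi⟩; exact absurd (hz hi) (Fin.succ_ne_zero i)
    rw [List.ofFn_succ, List.prod_cons, Module.End.mul_apply,
      ih (fun i => z i.succ) (hz.comp (Fin.succ_injective _)) fun i => hc _]
    have := colorFlip_single (z 0) σ (fun α => if ∃ i : Fin M, z i.succ = α then σ else c α)
    simp only [if_neg h0, hc] at this
    rw [this]
    congr 1
    funext α
    by_cases h : α = z 0
    · subst h; simp
    · simp [Function.update_of_ne h, Fin.exists_fin_succ, Ne.symm h]

theorem prod_colorFlip_referenceState {N M₁ M₂ : ℕ} {z : Fin M₁ → Fin N} {w : Fin M₂ → Fin N}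
    (h : IsPlacement z w) :
    ((List.ofFn fun i => colorFlip (z i) blue green).prod *
      (List.ofFn fun k => colorFlip (w k) red green).prod) (referenceState N) =
      Pi.single (config z w) 1 := by
  rw [Module.End.mul_apply, referenceState, prod_colorFlip_single _ _ h.inj_right _ fun _ => rfl,
    prod_colorFlip_single _ _ h.inj_left]
  · rfl
  · intro i
    rw [if_neg]
    rintro ⟨k, hk⟩
    exact h.disj i k hk.symm

theorem ket_apply_eq_zero {N M₁ M₂ : ℕ} (Ψ : WaveFunction M₁ M₂) {c : Fin N → Color}
    (hc : ∀ (z : Fin M₁ → Fin N) (w : Fin M₂ → Fin N), IsPlacement z w → c ≠ config z w) :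
    ket N Ψ c = 0 := by
  rw [ket, Finset.sum_apply]
  refine Finset.sum_eq_zero fun z _ => ?_
  rw [Finset.sum_apply]
  refine Finset.sum_eq_zero fun w _ => ?_
  split_ifs with h
  · have hp : IsPlacement z w := ⟨h.1.injective, h.2.1.injective, h.2.2⟩
    rw [prod_colorFlip_referenceState hp]
    simp [hc z w hp]
  · rfl

theorem exists_strictMono_comp_perm {N M : ℕ} {z : Fin M → Fin N} (hz : Function.Injective z) :
    ∃ σ : Equiv.Perm (Fin M), StrictMono (z ∘ σ) :=
  ⟨Tuple.sort z, (Tuple.monotone_sort z).strictMono_of_injective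
    (hz.comp (Tuple.sort z).injective)⟩

/-- The amplitude of a configuration is the wave function at any enumeration of its blue and red
sites. -/
theorem ket_apply_config {N M₁ M₂ : ℕ} {Ψ : WaveFunction M₁ M₂} (hΨ : IsSymmetric Ψ)
    {z : Fin M₁ → Fin N} {w : Fin M₂ → Fin N} (h : IsPlacement z w) :
    ket N Ψ (config z w) = Ψ (fun i => site N (z i)) fun k => site N (w k) := by
  obtain ⟨σ, hσ⟩ := exists_strictMono_comp_perm h.inj_left
  obtain ⟨τ, hτ⟩ := exists_strictMono_comp_perm h.inj_right
  have hp : IsPlacement (z ∘ σ) (w ∘ τ) := ⟨hσ.injective, hτ.injective, fun i k => h.disj _ _⟩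
  have hc : config z w = config (z ∘ σ) (w ∘ τ) := by
    refine eq_config hp (fun i => config_left _) (fun k => config_right h _) fun α h1 h2 => ?_
    refine config_eq_green.2 ⟨fun i => ?_, fun k => ?_⟩
    · simpa using h1 (σ.symm i)
    · simpa using h2 (τ.symm k)
  have hval : Ψ (fun i => site N (z i)) (fun k => site N (w k)) =
      Ψ (fun i => site N ((z ∘ σ) i)) fun k => site N ((w ∘ τ) k) := by
    rw [← hΨ.left σ, ← hΨ.right τ]; rfl
  -- increasing enumerations of the blue and red sites are unique
  have huniq : ∀ (z' : Fin M₁ → Fin N) (w' : Fin M₂ → Fin N), StrictMono z' → StrictMono w' →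
      IsPlacement z' w' → config (z ∘ σ) (w ∘ τ) = config z' w' → z' = z ∘ σ ∧ w' = w ∘ τ := by
    intro z' w' hz' hw' hp' he
    constructor
    · refine (StrictMono.range_inj hz' hσ).1 ?_
      ext α
      rw [Set.mem_range, Set.mem_range, ← config_eq_blue (w := w'),
        ← config_eq_blue (w := w ∘ τ), he]
    · refine (StrictMono.range_inj hw' hτ).1 ?_
      ext α
      rw [Set.mem_range, Set.mem_range, ← config_eq_red hp', ← config_eq_red hp, he]
  rw [hc, hval, ket, Finset.sum_apply, Finset.sum_eq_single (z ∘ σ), Finset.sum_apply,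
    Finset.sum_eq_single (w ∘ τ)]
  · rw [if_pos ⟨hσ, hτ, hp.disj⟩, prod_colorFlip_referenceState hp]
    simp
  · intro w' _ hw'
    split_ifs with hh
    · have hp' : IsPlacement (z ∘ σ) w' := ⟨hh.1.injective, hh.2.1.injective, hh.2.2⟩
      rw [prod_colorFlip_referenceState hp', Pi.smul_apply, Pi.single_apply, if_neg, smul_zero]
      exact fun he => hw' (huniq _ _ hh.1 hh.2.1 hp' he).2
    · rfl
  · simp
  · intro z' _ hz'
    rw [Finset.sum_apply]
    refine Finset.sum_eq_zero fun w' _ => ?_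
    split_ifs with hh
    · have hp' : IsPlacement z' w' := ⟨hh.1.injective, hh.2.1.injective, hh.2.2⟩
      rw [prod_colorFlip_referenceState hp', Pi.smul_apply, Pi.single_apply, if_neg, smul_zero]
      exact fun he => hz' (huniq _ _ hh.1 hh.2.1 hp' he).1
    · rfl
  · simp

theorem ket_sum {N M₁ M₂ : ℕ} {κ : Type*} (s : Finset κ) (a : κ → ℂ) (Ψ : κ → WaveFunction M₁ M₂) :
    ket N (fun z w => ∑ l ∈ s, a l * Ψ l z w) = ∑ l ∈ s, a l • ket N (Ψ l) := by
  simp only [ket, Finset.smul_sum]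
  symm
  rw [Finset.sum_comm]
  refine Finset.sum_congr rfl fun z _ => ?_
  rw [Finset.sum_comm]
  refine Finset.sum_congr rfl fun w _ => ?_
  split_ifs
  · rw [Finset.sum_smul]
    exact Finset.sum_congr rfl fun _ _ => by rw [smul_smul]
  · simp

section exchange

variable {N M₁ M₂ : ℕ} {z : Fin M₁ → Fin N} {w : Fin M₂ → Fin N}

/-- Exchanging two sites permutes the set of configurations with given particle numbers. -/
theorem config_comp_perm (h : IsPlacement z w) (π : Equiv.Perm (Fin N)) :
    IsPlacement (π.symm ∘ z) (π.symm ∘ w) ∧ config z w ∘ π = config (π.symm ∘ z) (π.symm ∘ w) := by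
  have hp : IsPlacement (π.symm ∘ z) (π.symm ∘ w) :=
    ⟨π.symm.injective.comp h.inj_left, π.symm.injective.comp h.inj_right,
      fun i k he => h.disj i k (π.symm.injective he)⟩
  refine ⟨hp, eq_config hp (fun i => ?_) (fun k => ?_) fun α h1 h2 => ?_⟩
  · simp [config_left]
  · simpa using config_right h k
  · refine config_eq_green.2 ⟨fun i he => h1 i ?_, fun k he => h2 k ?_⟩ <;> simp [he]

theorem swap_comp_eq_update {ι : Type*} [DecidableEq ι] {N : ℕ} {z : ι → Fin N}
    (hz : Function.Injective z) (i : ι) {β : Fin N} (hβ : ∀ j, z j ≠ β) :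
    (Equiv.swap (z i) β).symm ∘ z = Function.update z i β := by
  funext j
  by_cases hj : j = i
  · subst hj; simp
  · simp [Function.update_of_ne hj, Equiv.swap_apply_of_ne_of_ne (hz.ne hj) (hβ j)]

theorem swap_comp_eq_self {ι : Type*} {N : ℕ} {z : ι → Fin N} {α β : Fin N} (hα : ∀ j, z j ≠ α)
    (hβ : ∀ j, z j ≠ β) : (Equiv.swap α β).symm ∘ z = z := by
  funext j
  simp [Equiv.swap_apply_of_ne_of_ne (hα j) (hβ j)]

theorem site_comp_update {ι : Type*} [DecidableEq ι] {N : ℕ} (z : ι → Fin N) (i : ι) (β : Fin N) :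
    (fun j => site N (Function.update z i β j)) =
      Function.update (fun j => site N (z j)) i (site N β) := by
  funext j
  by_cases hj : j = i
  · subst hj; simp
  · simp [Function.update_of_ne hj]

variable {Ψ : WaveFunction M₁ M₂}

theorem ket_exchange_left_green (hΨ : IsSymmetric Ψ) (h : IsPlacement z w) (i : Fin M₁)
    {β : Fin N} (hβ : config z w β = green) :
    ket N Ψ (config z w ∘ Equiv.swap (z i) β) =
      Ψ (Function.update (fun j => site N (z j)) i (site N β)) fun k => site N (w k) := by
  obtain ⟨h1, h2⟩ := config_eq_green.1 hβ
  obtain ⟨hp, he⟩ := config_comp_perm h (Equiv.swap (z i) β)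
  rw [he, ket_apply_config hΨ hp, swap_comp_eq_update h.inj_left i h1,
    swap_comp_eq_self (fun k => (h.disj i k).symm) h2, site_comp_update]

theorem ket_exchange_right_green (hΨ : IsSymmetric Ψ) (h : IsPlacement z w) (k : Fin M₂)
    {β : Fin N} (hβ : config z w β = green) :
    ket N Ψ (config z w ∘ Equiv.swap (w k) β) =
      Ψ (fun j => site N (z j)) (Function.update (fun j => site N (w j)) k (site N β)) := by
  obtain ⟨h1, h2⟩ := config_eq_green.1 hβ
  obtain ⟨hp, he⟩ := config_comp_perm h (Equiv.swap (w k) β)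
  rw [he, ket_apply_config hΨ hp, swap_comp_eq_update h.inj_right k h2,
    swap_comp_eq_self (fun i => h.disj i k) h1, site_comp_update]

theorem ket_exchange_left_right (hΨ : IsSymmetric Ψ) (h : IsPlacement z w) (i : Fin M₁)
    (k : Fin M₂) :
    ket N Ψ (config z w ∘ Equiv.swap (z i) (w k)) =
      Ψ (Function.update (fun j => site N (z j)) i (site N (w k)))
        (Function.update (fun l => site N (w l)) k (site N (z i))) := by
  obtain ⟨hp, he⟩ := config_comp_perm h (Equiv.swap (z i) (w k))
  rw [he, ket_apply_config hΨ hp, swap_comp_eq_update h.inj_left i fun j => h.disj j k,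
    Equiv.swap_comm, swap_comp_eq_update h.inj_right k fun l => (h.disj i l).symm,
    site_comp_update, site_comp_update]

/-- Exchanging two particles of the same color does nothing. -/
theorem comp_swap_of_eq {N : ℕ} {c : Fin N → Color} {α β : Fin N} (h : c α = c β) :
    c ∘ Equiv.swap α β = c := by
  funext x
  by_cases h1 : x = α
  · subst h1; simp [h]
  · by_cases h2 : x = β
    · subst h2; simp [h]
    · simp [Equiv.swap_apply_of_ne_of_ne h1 h2]

end exchange

/-! ### Sums over the lattice -/

section lattice

variable {N : ℕ}

theorem site_eq_pow (α : Fin N) :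
    site N α = Complex.exp (2 * Real.pi * Complex.I / N) ^ (α : ℕ) := by
  rw [site, ← Complex.exp_nat_mul]
  congr 1
  ring

theorem site_ne_zero (α : Fin N) : site N α ≠ 0 := Complex.exp_ne_zero _

theorem site_pow_card (α : Fin N) : site N α ^ N = 1 := by
  have hN : N ≠ 0 := fun h => by subst h; exact α.elim0
  rw [site_eq_pow, ← pow_mul, mul_comm (α : ℕ), pow_mul,
    (Complex.isPrimitiveRoot_exp N hN).pow_eq_one, one_pow]

theorem site_injective : Function.Injective (site N) := by
  intro α β h
  have hN : N ≠ 0 := fun h => by subst h; exact α.elim0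
  rw [site_eq_pow, site_eq_pow] at h
  exact Fin.ext ((Complex.isPrimitiveRoot_exp N hN).pow_inj α.2 β.2 h)

theorem norm_site (α : Fin N) : ‖site N α‖ = 1 := by
  rw [site, show (2 * Real.pi * Complex.I * ((α : ℕ) : ℂ) / (N : ℂ) : ℂ) =
    ((2 * Real.pi * (α : ℕ) / N : ℝ) : ℂ) * Complex.I by push_cast; ring]
  exact Complex.norm_exp_ofReal_mul_I _

theorem star_site (α : Fin N) : star (site N α) = (site N α)⁻¹ := by
  rw [Complex.inv_def, Complex.normSq_eq_norm_sq, norm_site]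
  simp

/-- The coupling is a rational function of the sites (with both sides zero for `α = β`). -/
theorem coupling_eq (α β : Fin N) :
    coupling α β = -(site N α * site N β) / (site N α - site N β) ^ 2 := by
  have h : ((‖site N α - site N β‖ ^ 2 : ℝ) : ℂ) =
      (site N α - site N β) * ((site N α)⁻¹ - (site N β)⁻¹) := by
    rw [← Complex.normSq_eq_norm_sq, ← Complex.mul_conj, map_sub]
    simp only [← star_site]
    rfl
  rw [coupling, Complex.ofReal_div, h]
  have ha := site_ne_zero α
  have hb := site_ne_zero β
  by_cases hab : site N α - site N β = 0
  · simp [hab]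
  have : (site N α)⁻¹ - (site N β)⁻¹ = -(site N α - site N β) / (site N α * site N β) := by
    field_simp; ring
  rw [this]
  field_simp
  simp

theorem sum_site_pow {s : ℕ} (h0 : 0 < s) (hs : s < N) : ∑ α, site N α ^ s = 0 := by
  have hN : N ≠ 0 := by omega
  set ω := Complex.exp (2 * Real.pi * Complex.I / N) with hω
  have hprim : IsPrimitiveRoot ω N := Complex.isPrimitiveRoot_exp N hN
  have h1 : ω ^ s ≠ 1 := hprim.pow_ne_one_of_pos_of_lt h0.ne' hs
  have : ∑ α : Fin N, site N α ^ s = ∑ j ∈ Finset.range N, (ω ^ s) ^ j := by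
    rw [← Fin.sum_univ_eq_sum_range (fun j => (ω ^ s) ^ j)]
    exact Finset.sum_congr rfl fun α _ => by rw [site_eq_pow, ← hω, ← pow_mul, ← pow_mul, mul_comm]
  rw [this, geom_sum_eq h1, ← pow_mul, mul_comm, pow_mul, hprim.pow_eq_one]
  simp

/-- `∑_β |η_α - η_β|⁻² (η_β / η_α)^s`. -/
noncomputable def latticeSum (α : Fin N) (s : ℕ) : ℂ :=
  ∑ β, coupling α β * (site N β / site N α) ^ s

theorem latticeSum_succ_succ (α : Fin N) {s : ℕ} (hs : s + 2 ≤ N) :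
    latticeSum α (s + 2) = 2 * latticeSum α (s + 1) - latticeSum α s + 1 := by
  have ha := site_ne_zero α
  have key : ∀ β, coupling α β * (site N β / site N α) ^ (s + 2) =
      2 * (coupling α β * (site N β / site N α) ^ (s + 1)) -
        coupling α β * (site N β / site N α) ^ s +
        ((if β = α then 1 else 0) - site N β ^ (s + 1) / site N α ^ (s + 1)) := by
    intro β
    by_cases h : β = α
    · subst h
      rw [coupling_self]; simp [site_ne_zero]
    · have hne : site N α - site N β ≠ 0 := sub_ne_zero.2 fun h' => h (site_injective h').symm
      rw [coupling_eq, if_neg h]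
      simp only [div_pow]
      field_simp
      ring
  have h0 : ∑ β, site N β ^ (s + 1) / site N α ^ (s + 1) = 0 := by
    rw [← Finset.sum_div, sum_site_pow (by omega) (by omega), zero_div]
  simp only [latticeSum, key, Finset.sum_add_distrib, Finset.sum_sub_distrib, ← Finset.mul_sum, h0]
  simp

theorem latticeSum_eq (α : Fin N) {s : ℕ} (hs : s ≤ N) :
    latticeSum α s = ((N : ℂ) ^ 2 - 1) / 12 - s * (N - s) / 2 := by
  have hN : 0 < N := α.pos
  have hN' : (N : ℂ) ≠ 0 := by exact_mod_cast hN.ne'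
  -- the second difference in `s` is `1`, so the sum is quadratic in `s`; periodicity fixes the
  -- linear term and the vanishing of the sum over all `s < N` the constant term
  set d := latticeSum α 1 - latticeSum α 0 with hd
  have h1 : ∀ s, s + 1 ≤ N → latticeSum α s = latticeSum α 0 + s * d + s * (s - 1) / 2 ∧
      latticeSum α (s + 1) = latticeSum α 0 + (s + 1) * d + (s + 1) * s / 2 := by
    intro s
    induction s with
    | zero => intro _; simp [hd]
    | succ s ih =>
      intro hs
      obtain ⟨ha, hb⟩ := ih (by omega)
      refine ⟨by rw [hb]; push_cast; ring, ?_⟩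
      rw [latticeSum_succ_succ α hs, ha, hb]; push_cast; ring
  have h2 : ∀ s ≤ N, latticeSum α s = latticeSum α 0 + s * d + s * (s - 1) / 2 := by
    intro s hs
    rcases s with _ | s
    · simp
    · rw [(h1 s hs).2]; push_cast; ring
  have hper : latticeSum α N = latticeSum α 0 := by
    simp only [latticeSum, div_pow, site_pow_card, pow_zero, div_one]
  have hd' : d = -((N : ℂ) - 1) / 2 := by
    have := h2 N le_rfl
    rw [hper] at this
    field_simp
    have h3 : (N : ℂ) * (2 * d + (N - 1)) = 0 := by linear_combination (-2 : ℂ) * this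
    linear_combination (mul_eq_zero.1 h3).resolve_left hN'
  have hsum : ∑ s ∈ Finset.range N, latticeSum α s = 0 := by
    simp only [latticeSum]
    rw [Finset.sum_comm]
    refine Finset.sum_eq_zero fun β _ => ?_
    rw [← Finset.mul_sum]
    by_cases h : β = α
    · rw [h, coupling_self, zero_mul]
    · rw [geom_sum_eq, div_pow, site_pow_card, site_pow_card]
      · simp
      · rw [Ne, div_eq_one_iff_eq (site_ne_zero α)]
        exact fun h' => h (site_injective h')
  have hpoly : ∀ n ≤ N, ∑ s ∈ Finset.range n, latticeSum α s =
      n * latticeSum α 0 + n * (n - 1) / 2 * d + n * (n - 1) * (n - 2) / 6 := by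
    intro n hn
    induction n with
    | zero => simp
    | succ n ih =>
      rw [Finset.sum_range_succ, ih (by omega), h2 n (by omega)]; push_cast; ring
  have h4 := hpoly N le_rfl
  rw [hsum, hd'] at h4
  have h5 : (N : ℂ) * (latticeSum α 0 - ((N : ℂ) ^ 2 - 1) / 12) = 0 := by
    linear_combination (-1 : ℂ) * h4
  rw [h2 s hs, hd']
  linear_combination (mul_eq_zero.1 h5).resolve_left hN'

theorem sum_coupling (α : Fin N) : ∑ β, coupling α β = ((N : ℂ) ^ 2 - 1) / 12 := by
  have := latticeSum_eq α (Nat.zero_le N)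
  simpa [latticeSum] using this

/-- Hopping with amplitude `|η_α - η_β|⁻²` acts on polynomials of degree less than `N`
as a second order differential operator. -/
theorem sum_coupling_mul_eval (α : Fin N) (p : Polynomial ℂ)
    (hp : p.natDegree < N) :
    ∑ β, coupling α β * p.eval (site N β) =
      ((N : ℂ) ^ 2 - 1) / 12 * p.eval (site N α)
        - ((N : ℂ) - 1) / 2 * (site N α * p.derivative.eval (site N α))
        + 1 / 2 * (site N α ^ 2 * p.derivative.derivative.eval (site N α)) := by
  have ha := site_ne_zero α
  have hmono : ∀ s ≤ N, ∑ β, coupling α β * site N β ^ s =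
      site N α ^ s * (((N : ℂ) ^ 2 - 1) / 12 - s * (N - s) / 2) := by
    intro s hs
    rw [← latticeSum_eq α hs, latticeSum, Finset.mul_sum]
    refine Finset.sum_congr rfl fun β _ => ?_
    rw [div_pow]; field_simp
  have d1 : site N α * p.derivative.eval (site N α) =
      ∑ s ∈ Finset.range N, p.coeff s * (s * site N α ^ s) := by
    rw [Polynomial.derivative_eval, Polynomial.sum_over_range' p (by simp) N hp, Finset.mul_sum]
    refine Finset.sum_congr rfl fun s _ => ?_
    rcases s with _ | s
    · simp
    · simp; ring
  have d2 : site N α ^ 2 * p.derivative.derivative.eval (site N α) =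
      ∑ s ∈ Finset.range N, p.coeff s * (s * (s - 1) * site N α ^ s) := by
    conv_lhs => rw [Polynomial.as_sum_range' p N hp]
    simp only [Polynomial.derivative_sum, Polynomial.derivative_monomial, Polynomial.eval_finsetSum,
      Polynomial.eval_monomial, Finset.mul_sum]
    refine Finset.sum_congr rfl fun s _ => ?_
    rcases s with _ | _ | s
    · simp
    · simp
    · simp; ring
  rw [d1, d2, Polynomial.eval_eq_sum_range' hp]
  simp only [Polynomial.eval_eq_sum_range' hp, Finset.mul_sum]
  rw [Finset.sum_comm, ← Finset.sum_sub_distrib, ← Finset.sum_add_distrib]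
  refine Finset.sum_congr rfl fun s hs => ?_
  have : ∑ β, coupling α β * (p.coeff s * site N β ^ s) =
      p.coeff s * ∑ β, coupling α β * site N β ^ s := by
    rw [Finset.mul_sum]; exact Finset.sum_congr rfl fun _ _ => by ring
  rw [this, hmono s (Finset.mem_range.1 hs).le]
  ring

end lattice

/-! ### Sums of inverse differences -/

section inverseDifferences

variable {ι κ : Type*} [Fintype ι] [Fintype κ]

/-- `∑_j (x - v_j)⁻¹`. For `x = v_i` the term `j = i` is zero, so that the sum is effectively over
`j ≠ i`. -/
noncomputable def invSum (v : ι → ℂ) (x : ℂ) : ℂ := ∑ j, (x - v j)⁻¹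

/-- `∑_j (x - v_j)⁻²`, again without the term `v_j = x`. -/
noncomputable def invSqSum (v : ι → ℂ) (x : ℂ) : ℂ := ∑ j, ((x - v j)⁻¹) ^ 2

theorem sum_mul_invSum {z : ι → ℂ} (hz : Function.Injective z) :
    ∑ i, z i * invSum z (z i) = (Fintype.card ι : ℂ) * (Fintype.card ι - 1) / 2 := by
  classical
  have h1 : ∑ i, z i * invSum z (z i) = ∑ i, ∑ j, z i * (z i - z j)⁻¹ := by
    simp only [invSum, Finset.mul_sum]
  have h2 : ∑ i, ∑ j, z i * (z i - z j)⁻¹ = ∑ i, ∑ j, z j * (z j - z i)⁻¹ := Finset.sum_comm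
  have h3 : ∑ i, ∑ j, (z i * (z i - z j)⁻¹ + z j * (z j - z i)⁻¹) =
      ∑ i : ι, ∑ j : ι, ((1 : ℂ) - if j = i then 1 else 0) := by
    refine Finset.sum_congr rfl fun i _ => Finset.sum_congr rfl fun j _ => ?_
    by_cases h : j = i
    · simp [h]
    · have h' : z i - z j ≠ 0 := sub_ne_zero.2 fun e => h (hz e).symm
      rw [if_neg h, ← neg_sub (z i) (z j), inv_neg]
      field_simp
      ring
  simp only [Finset.sum_add_distrib, Finset.sum_sub_distrib, Finset.sum_ite_eq', Finset.mem_univ,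
    if_true, Finset.sum_const, Finset.card_univ, nsmul_eq_mul, mul_one] at h3
  rw [h1]
  linear_combination (1 / 2 : ℂ) * h3 + (1 / 2 : ℂ) * h2

theorem sum_sq_mul_invSqSum {z : ι → ℂ} (hz : Function.Injective z) :
    ∑ i, z i ^ 2 * invSqSum z (z i) + ∑ i, ∑ j, -(z i * z j) / (z i - z j) ^ 2 =
      (Fintype.card ι : ℂ) * (Fintype.card ι - 1) / 2 := by
  rw [← sum_mul_invSum hz, ← Finset.sum_add_distrib]
  refine Finset.sum_congr rfl fun i _ => ?_
  simp only [invSum, invSqSum, Finset.mul_sum]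
  rw [← Finset.sum_add_distrib]
  refine Finset.sum_congr rfl fun j _ => ?_
  by_cases h : z i - z j = 0
  · simp [h]
  · field_simp; ring

/-- `x² / ((x - y)(x - t)) + cyc = 1`, summed over triples. -/
theorem sum_sq_mul_invSum_sq {z : ι → ℂ} (hz : Function.Injective z) :
    ∑ i, z i ^ 2 * (invSum z (z i) ^ 2 - invSqSum z (z i)) =
      (Fintype.card ι : ℂ) * (Fintype.card ι - 1) * (Fintype.card ι - 2) / 3 := by
  classical
  set T : ι → ι → ι → ℂ := fun i j l =>
    if j = l then 0 else z i ^ 2 * ((z i - z j)⁻¹ * (z i - z l)⁻¹) with hT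
  have h1 : ∑ i, z i ^ 2 * (invSum z (z i) ^ 2 - invSqSum z (z i)) = ∑ i, ∑ j, ∑ l, T i j l := by
    refine Finset.sum_congr rfl fun i _ => ?_
    have e1 : invSum z (z i) ^ 2 = ∑ j, ∑ l, (z i - z j)⁻¹ * (z i - z l)⁻¹ := by
      rw [sq, invSum, Finset.sum_mul_sum]
    have e2 : invSqSum z (z i) = ∑ j, ∑ l, if j = l then (z i - z j)⁻¹ * (z i - z l)⁻¹ else 0 := by
      simp [invSqSum, sq]
    rw [e1, e2, ← Finset.sum_sub_distrib, Finset.mul_sum]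
    refine Finset.sum_congr rfl fun j _ => ?_
    rw [← Finset.sum_sub_distrib, Finset.mul_sum]
    refine Finset.sum_congr rfl fun l _ => ?_
    simp only [hT]; split_ifs <;> simp
  have hrot : ∀ U : ι → ι → ι → ℂ, ∑ i, ∑ j, ∑ l, U i j l = ∑ i, ∑ j, ∑ l, U j l i := by
    intro U
    calc _ = ∑ j, ∑ l, ∑ i, U j l i := rfl
      _ = ∑ j, ∑ i, ∑ l, U j l i := Finset.sum_congr rfl fun j _ => Finset.sum_comm
      _ = _ := Finset.sum_comm
  have h2 : ∑ i, ∑ j, ∑ l, T i j l = ∑ i, ∑ j, ∑ l, T j l i := hrot T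
  have h3 : ∑ i, ∑ j, ∑ l, T i j l = ∑ i, ∑ j, ∑ l, T l i j :=
    h2.trans (hrot fun i j l => T j l i)
  have hne {x y : ι} (h : x ≠ y) : z x - z y ≠ 0 := sub_ne_zero.2 fun e => h (hz e)
  have h4 : ∑ i, ∑ j, ∑ l, (T i j l + T j l i + T l i j) =
      ∑ i : ι, ∑ j : ι, ∑ l : ι, ((1 : ℂ) - (if j = i then 1 else 0) - (if l = i then 1 else 0)
        - (if l = j then 1 else 0) + 2 * (if l = i then if j = i then 1 else 0 else 0)) := by
    refine Finset.sum_congr rfl fun i _ => Finset.sum_congr rfl fun j _ =>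
      Finset.sum_congr rfl fun l _ => ?_
    by_cases h1 : j = i
    · subst h1
      by_cases h2 : l = j
      · subst h2; simp [hT]; norm_num
      · simp [hT, h2]
    · by_cases h2 : l = i
      · subst h2
        simp [hT, h1, Ne.symm h1]
      · by_cases h3 : l = j
        · subst h3
          simp [hT, h1]
        · have n1 := hne (Ne.symm h1)
          have n2 := hne (Ne.symm h2)
          have n3 := hne (Ne.symm h3)
          simp only [hT, if_neg (Ne.symm h3), if_neg h2, if_neg (Ne.symm h1), if_neg h1, if_neg h3]
          rw [← neg_sub (z i) (z j), ← neg_sub (z i) (z l), ← neg_sub (z j) (z l)]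
          simp only [inv_neg]
          field_simp
          ring
  simp only [Finset.sum_add_distrib, Finset.sum_sub_distrib, Finset.sum_ite_eq', Finset.mem_univ,
    if_true, Finset.sum_const, Finset.card_univ, nsmul_eq_mul, mul_one, ← Finset.mul_sum] at h4
  rw [h1]
  linear_combination (1 / 3 : ℂ) * h4 + (1 / 3 : ℂ) * h2 + (1 / 3 : ℂ) * h3

variable {z : ι → ℂ} {w : κ → ℂ}

theorem sum_mul_invSum_add (h : ∀ i k, z i ≠ w k) :
    ∑ i, z i * invSum w (z i) + ∑ k, w k * invSum z (w k) =
      (Fintype.card ι : ℂ) * Fintype.card κ := by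
  have h1 : ∑ k, w k * invSum z (w k) = ∑ i, ∑ k, w k * (w k - z i)⁻¹ := by
    simp only [invSum, Finset.mul_sum]; exact Finset.sum_comm
  have : ∀ i, z i * invSum w (z i) + ∑ k, w k * (w k - z i)⁻¹ = (Fintype.card κ : ℂ) := by
    intro i
    rw [invSum, Finset.mul_sum, ← Finset.sum_add_distrib,
      Finset.sum_congr rfl fun k _ => (?_ : _ = (1 : ℂ))]
    · simp
    · have h' : z i - w k ≠ 0 := sub_ne_zero.2 (h i k)
      rw [← neg_sub (z i) (w k), inv_neg]
      field_simp
      ring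
  rw [h1, ← Finset.sum_add_distrib]
  simp [this]

theorem sum_sq_mul_invSqSum_add (h : ∀ i k, z i ≠ w k) :
    ∑ i, z i ^ 2 * invSqSum w (z i) + ∑ i, ∑ k, -(z i * w k) / (z i - w k) ^ 2 =
      ∑ i, z i * invSum w (z i) := by
  rw [← Finset.sum_add_distrib]
  refine Finset.sum_congr rfl fun i _ => ?_
  simp only [invSum, invSqSum, Finset.mul_sum]
  rw [← Finset.sum_add_distrib]
  refine Finset.sum_congr rfl fun k _ => ?_
  have h' : z i - w k ≠ 0 := sub_ne_zero.2 (h i k)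
  field_simp; ring

/-- `x² / ((x - y)(x - t)) + cyc = 1`, summed over triples of two particles of one color and one
particle of the other. -/
theorem sum_sq_mul_invSum_mul_invSum (hz : Function.Injective z) (h : ∀ i k, z i ≠ w k) :
    ∑ i, z i ^ 2 * (invSum z (z i) * invSum w (z i)) +
        1 / 2 * ∑ k, w k ^ 2 * (invSum z (w k) ^ 2 - invSqSum z (w k)) =
      (Fintype.card ι : ℂ) * (Fintype.card ι - 1) / 2 * Fintype.card κ := by
  classical
  set T : ι → ι → κ → ℂ := fun i j k => z i ^ 2 * ((z i - z j)⁻¹ * (z i - w k)⁻¹) with hT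
  set S : ι → ι → κ → ℂ := fun i j k =>
    if j = i then 0 else w k ^ 2 * ((w k - z i)⁻¹ * (w k - z j)⁻¹) with hS
  have h1 : ∑ i, z i ^ 2 * (invSum z (z i) * invSum w (z i)) = ∑ i, ∑ j, ∑ k, T i j k := by
    refine Finset.sum_congr rfl fun i _ => ?_
    rw [invSum, invSum, Finset.sum_mul_sum]
    simp only [Finset.mul_sum, hT]
  have h2 : ∑ k, w k ^ 2 * (invSum z (w k) ^ 2 - invSqSum z (w k)) = ∑ i, ∑ j, ∑ k, S i j k := by
    have : ∀ k, w k ^ 2 * (invSum z (w k) ^ 2 - invSqSum z (w k)) = ∑ i, ∑ j, S i j k := by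
      intro k
      have e1 : invSum z (w k) ^ 2 = ∑ i, ∑ j, (w k - z i)⁻¹ * (w k - z j)⁻¹ := by
        rw [sq, invSum, Finset.sum_mul_sum]
      have e2 : invSqSum z (w k) =
          ∑ i, ∑ j, if j = i then (w k - z i)⁻¹ * (w k - z j)⁻¹ else 0 := by
        simp [invSqSum, sq]
      rw [e1, e2, ← Finset.sum_sub_distrib, Finset.mul_sum]
      refine Finset.sum_congr rfl fun j _ => ?_
      rw [← Finset.sum_sub_distrib, Finset.mul_sum]
      refine Finset.sum_congr rfl fun l _ => ?_
      simp only [hS]; split_ifs <;> simp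
    simp only [this]
    rw [Finset.sum_comm]
    exact Finset.sum_congr rfl fun i _ => Finset.sum_comm
  have h3 : ∑ i, ∑ j, ∑ k, T i j k = ∑ i, ∑ j, ∑ k, T j i k := Finset.sum_comm
  have h4 : ∑ i, ∑ j, ∑ k, (T i j k + T j i k + S i j k) =
      ∑ i : ι, ∑ j : ι, ∑ k : κ, ((1 : ℂ) - (if j = i then 1 else 0)) := by
    refine Finset.sum_congr rfl fun i _ => Finset.sum_congr rfl fun j _ =>
      Finset.sum_congr rfl fun k _ => ?_
    by_cases h1 : j = i
    · subst h1; simp [hT, hS]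
    · have n1 : z i - z j ≠ 0 := sub_ne_zero.2 fun e => h1 (hz e).symm
      have n2 : z i - w k ≠ 0 := sub_ne_zero.2 (h i k)
      have n3 : z j - w k ≠ 0 := sub_ne_zero.2 (h j k)
      simp only [hT, hS, if_neg h1]
      rw [← neg_sub (z i) (z j), ← neg_sub (z i) (w k), ← neg_sub (z j) (w k)]
      simp only [inv_neg]
      field_simp
      ring
  simp only [Finset.sum_add_distrib, Finset.sum_sub_distrib, Finset.sum_ite_eq', Finset.mem_univ,
    if_true, Finset.sum_const, Finset.card_univ, nsmul_eq_mul, mul_one, ← Finset.mul_sum] at h4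
  rw [h1, h2]
  linear_combination (1 / 2 : ℂ) * h4 + (1 / 2 : ℂ) * h3

end inverseDifferences

/-! ### Polynomials with given roots -/

section rootPoly

open Polynomial

variable {ι : Type*}

/-- `∏_{j ∈ s} (X - v_j)`. -/
noncomputable def rootPoly (v : ι → ℂ) (s : Finset ι) : ℂ[X] := ∏ j ∈ s, (X - C (v j))

theorem rootPoly_monic (v : ι → ℂ) (s : Finset ι) : (rootPoly v s).Monic :=
  monic_prod_of_monic _ _ fun _ _ => monic_X_sub_C _

theorem natDegree_rootPoly (v : ι → ℂ) (s : Finset ι) : (rootPoly v s).natDegree = s.card := by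
  simp [rootPoly, natDegree_prod_of_monic _ _ fun j _ => monic_X_sub_C (v j)]

theorem eval_rootPoly (v : ι → ℂ) (s : Finset ι) (x : ℂ) :
    (rootPoly v s).eval x = ∏ j ∈ s, (x - v j) := by
  simp [rootPoly, eval_prod]

theorem eval_rootPoly_ne_zero {v : ι → ℂ} {s : Finset ι} {x : ℂ} (h : ∀ j ∈ s, x ≠ v j) :
    (rootPoly v s).eval x ≠ 0 := by
  rw [eval_rootPoly]
  exact Finset.prod_ne_zero_iff.2 fun j hj => sub_ne_zero.2 (h j hj)

theorem rootPoly_erase_mul [DecidableEq ι] (v : ι → ℂ) {s : Finset ι} {i : ι} (hi : i ∈ s) :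
    (X - C (v i)) * rootPoly v (s.erase i) = rootPoly v s := Finset.mul_prod_erase s _ hi

theorem eval_rootPoly_eq_zero {v : ι → ℂ} {s : Finset ι} {i : ι} (hi : i ∈ s) :
    (rootPoly v s).eval (v i) = 0 := by
  rw [eval_rootPoly]
  exact Finset.prod_eq_zero hi (sub_self _)

theorem eval_derivative_rootPoly {v : ι → ℂ} {s : Finset ι} {x : ℂ} (h : ∀ j ∈ s, x ≠ v j) :
    (derivative (rootPoly v s)).eval x =
        (rootPoly v s).eval x * ∑ j ∈ s, (x - v j)⁻¹ ∧
      (derivative (derivative (rootPoly v s))).eval x =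
        (rootPoly v s).eval x * ((∑ j ∈ s, (x - v j)⁻¹) ^ 2 - ∑ j ∈ s, ((x - v j)⁻¹) ^ 2) := by
  classical
  induction s using Finset.induction_on with
  | empty => simp [rootPoly]
  | insert a s ha ih =>
    obtain ⟨h1, h2⟩ := ih fun j hj => h j (Finset.mem_insert_of_mem hj)
    have hx : x - v a ≠ 0 := sub_ne_zero.2 (h a (Finset.mem_insert_self a s))
    have e : rootPoly v (insert a s) = (X - C (v a)) * rootPoly v s := Finset.prod_insert ha
    rw [e, Finset.sum_insert ha, Finset.sum_insert ha]
    simp only [derivative_mul, derivative_add, derivative_sub, derivative_X, derivative_C,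
      sub_zero, one_mul,
      eval_add, eval_mul, eval_sub, eval_X, eval_C, h1, h2]
    constructor
    · field_simp
    · field_simp
      ring

variable [Fintype ι]

theorem eval_derivative_rootPoly_univ {v : ι → ℂ} {x : ℂ} (h : ∀ j, x ≠ v j) :
    (derivative (rootPoly v Finset.univ)).eval x =
        (rootPoly v Finset.univ).eval x * invSum v x ∧
      (derivative (derivative (rootPoly v Finset.univ))).eval x =
        (rootPoly v Finset.univ).eval x * (invSum v x ^ 2 - invSqSum v x) :=
  eval_derivative_rootPoly fun j _ => h j

theorem eval_derivative_rootPoly_erase [DecidableEq ι] {v : ι → ℂ} (hv : Function.Injective v)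
    (i : ι) :
    (derivative (rootPoly v (Finset.univ.erase i))).eval (v i) =
        (rootPoly v (Finset.univ.erase i)).eval (v i) * invSum v (v i) ∧
      (derivative (derivative (rootPoly v (Finset.univ.erase i)))).eval (v i) =
        (rootPoly v (Finset.univ.erase i)).eval (v i) *
          (invSum v (v i) ^ 2 - invSqSum v (v i)) := by
  have h1 : invSum v (v i) = ∑ j ∈ Finset.univ.erase i, (v i - v j)⁻¹ :=
    (Finset.sum_erase _ (by simp)).symm
  have h2 : invSqSum v (v i) = ∑ j ∈ Finset.univ.erase i, ((v i - v j)⁻¹) ^ 2 :=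
    (Finset.sum_erase _ (by simp)).symm
  rw [h1, h2]
  exact eval_derivative_rootPoly fun j hj e => Finset.ne_of_mem_erase hj (hv e).symm

theorem eval_rootPoly_erase_self_ne_zero [DecidableEq ι] {v : ι → ℂ} (hv : Function.Injective v)
    (i : ι) : (rootPoly v (Finset.univ.erase i)).eval (v i) ≠ 0 :=
  eval_rootPoly_ne_zero fun _ hj e => Finset.ne_of_mem_erase hj (hv e).symm

/-- The sum of the residues of `p(y) / (B(y) (y - x)³)` vanishes, where `B = ∏_k (y - w_k)`
and `deg p ≤ deg B + 1`. -/
theorem sum_residues [DecidableEq ι] {w : ι → ℂ} (hw : Function.Injective w) {x : ℂ}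
    (hx : ∀ k, x ≠ w k) (p : ℂ[X]) (hp : p.natDegree ≤ Fintype.card ι + 1) :
    ∑ k, p.eval (w k) / ((rootPoly w (Finset.univ.erase k)).eval (w k) * (w k - x) ^ 3) =
      -(1 / 2) / (rootPoly w Finset.univ).eval x *
        ((derivative (derivative p)).eval x - 2 * (derivative p).eval x * invSum w x +
          p.eval x * (invSum w x ^ 2 + invSqSum w x)) := by
  set B := rootPoly w Finset.univ with hB
  set P : ι → ℂ[X] := fun k => rootPoly w (Finset.univ.erase k) with hP
  have hB0 : B.eval x ≠ 0 := eval_rootPoly_ne_zero fun k _ => hx k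
  obtain ⟨hB1, hB2⟩ := eval_derivative_rootPoly_univ hx
  rw [← hB] at hB1 hB2
  have hBP : ∀ k, B = (X - C (w k)) * P k := fun k =>
    (rootPoly_erase_mul w (Finset.mem_univ k)).symm
  -- `2 L / B³` is the functional `p ↦ (p / B)'' (x)`
  let L : ℂ[X] →ₗ[ℂ] ℂ :=
    (B.eval x ^ 2) • (leval x ∘ₗ derivative ∘ₗ derivative) -
      (2 * (B.eval x * (derivative B).eval x)) • (leval x ∘ₗ derivative) +
      (2 * (derivative B).eval x ^ 2 - B.eval x * (derivative (derivative B)).eval x) • leval x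
  have hL : ∀ q, L q = B.eval x ^ 2 * (derivative (derivative q)).eval x -
      2 * (B.eval x * (derivative B).eval x) * (derivative q).eval x +
      (2 * (derivative B).eval x ^ 2 - B.eval x * (derivative (derivative B)).eval x) * q.eval x :=
    fun q => rfl
  have hLP : ∀ k, L (P k) = 2 * B.eval x ^ 3 / (x - w k) ^ 3 := by
    intro k
    have hk : x - w k ≠ 0 := sub_ne_zero.2 (hx k)
    rw [hL, hBP k]
    simp only [derivative_mul, derivative_add, derivative_sub, derivative_X, derivative_C, sub_zero,
      one_mul, eval_add, eval_mul, eval_sub, eval_X, eval_C]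
    field_simp
    ring
  have hLB : ∀ q : ℂ[X], q.natDegree ≤ 1 → L (q * B) = 0 := by
    intro q hq
    have : derivative (derivative q) = 0 := by
      have := natDegree_derivative_le q
      rw [derivative_of_natDegree_zero (by omega)]
    rw [hL]
    simp only [derivative_mul, derivative_add, this, zero_mul, zero_add, eval_add, eval_mul]
    ring
  have hr : p %ₘ B = ∑ k, C (p.eval (w k) / (P k).eval (w k)) * P k := by
    refine eq_of_degrees_lt_of_eval_index_eq Finset.univ hw.injOn ?_ ?_ ?_
    · have := degree_modByMonic_lt p (rootPoly_monic w Finset.univ)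
      rwa [degree_eq_natDegree (rootPoly_monic w Finset.univ).ne_zero, natDegree_rootPoly] at this
    · refine (degree_sum_le _ _).trans_lt ?_
      rw [Finset.sup_lt_iff (WithBot.bot_lt_coe _)]
      intro k _
      rw [← smul_eq_C_mul]
      refine (degree_smul_le _ _).trans_lt ?_
      rw [degree_eq_natDegree (rootPoly_monic w _).ne_zero, natDegree_rootPoly]
      exact_mod_cast Finset.card_lt_card (Finset.erase_ssubset (Finset.mem_univ k))
    · intro l _
      have h1 : (p %ₘ B).eval (w l) = p.eval (w l) := by
        conv_rhs => rw [← modByMonic_add_div p B]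
        simp [hB, eval_rootPoly_eq_zero (Finset.mem_univ l)]
      rw [h1, eval_finsetSum, Finset.sum_eq_single l]
      · rw [eval_mul, eval_C, div_mul_cancel₀ _ (eval_rootPoly_erase_self_ne_zero hw l)]
      · intro k _ hk
        rw [eval_mul, hP]
        simp only
        rw [eval_rootPoly_eq_zero (Finset.mem_erase.2 ⟨hk.symm, Finset.mem_univ l⟩), mul_zero]
      · simp
  have hLp : L p = ∑ k, (p.eval (w k) / (P k).eval (w k)) * (2 * B.eval x ^ 3 / (x - w k) ^ 3) := by
    have hq : (p /ₘ B).natDegree ≤ 1 := by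
      rw [natDegree_divByMonic p (rootPoly_monic w Finset.univ), natDegree_rootPoly,
        Finset.card_univ]
      omega
    conv_lhs => rw [← modByMonic_add_div p B, map_add, mul_comm B, hLB _ hq, add_zero, hr, map_sum]
    refine Finset.sum_congr rfl fun k _ => ?_
    rw [C_mul', map_smul, hLP, smul_eq_mul]
  have hsum : ∑ k, p.eval (w k) / ((P k).eval (w k) * (w k - x) ^ 3) =
      -(1 / 2) / B.eval x ^ 3 * L p := by
    rw [hLp, Finset.mul_sum]
    refine Finset.sum_congr rfl fun k _ => ?_
    have hk : x - w k ≠ 0 := sub_ne_zero.2 (hx k)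
    have hPk : (P k).eval (w k) ≠ 0 := eval_rootPoly_erase_self_ne_zero hw k
    rw [← neg_sub x (w k)]
    field_simp
  rw [hsum, hL, hB1, hB2]
  field_simp
  ring

end rootPoly

theorem sum_invSum_self {ι : Type*} [Fintype ι] {z : ι → ℂ} : ∑ i, invSum z (z i) = 0 := by
  have h1 : ∑ i, ∑ j, (z i - z j)⁻¹ = ∑ i, ∑ j, (z j - z i)⁻¹ := Finset.sum_comm
  have h2 : ∑ i, ∑ j, (z j - z i)⁻¹ = -∑ i, ∑ j, (z i - z j)⁻¹ := by
    simp only [← Finset.sum_neg_distrib]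
    exact Finset.sum_congr rfl fun i _ => Finset.sum_congr rfl fun j _ => by
      rw [← neg_sub (z i), inv_neg]
  simp only [invSum]
  linear_combination (1 / 2 : ℂ) * h1 + (1 / 2 : ℂ) * h2

/-! ### Power sums over the roots of a polynomial with one root removed -/

section coefficients

open Polynomial

variable {ι : Type*} [Fintype ι] [DecidableEq ι] (z : ι → ℂ)

theorem sum_rootPoly_erase :
    ∑ i, rootPoly z (Finset.univ.erase i) = derivative (rootPoly z Finset.univ) := by
  simp [rootPoly, derivative_prod_finset]

theorem C_mul_rootPoly_erase (i : ι) :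
    C (z i) * rootPoly z (Finset.univ.erase i) =
      X * rootPoly z (Finset.univ.erase i) - rootPoly z Finset.univ := by
  rw [← rootPoly_erase_mul z (Finset.mem_univ i)]; ring

theorem mul_coeff_rootPoly_erase (i : ι) (m : ℕ) :
    z i * (rootPoly z (Finset.univ.erase i)).coeff m =
      (X * rootPoly z (Finset.univ.erase i)).coeff m - (rootPoly z Finset.univ).coeff m := by
  rw [← coeff_C_mul, C_mul_rootPoly_erase, coeff_sub]

theorem sum_coeff_rootPoly_erase (m : ℕ) :
    ∑ i, (rootPoly z (Finset.univ.erase i)).coeff m =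
      (m + 1) * (rootPoly z Finset.univ).coeff (m + 1) := by
  rw [← finsetSum_coeff, sum_rootPoly_erase, coeff_derivative, mul_comm]

theorem sum_coeff_X_mul_rootPoly_erase (m : ℕ) :
    ∑ i, (X * rootPoly z (Finset.univ.erase i)).coeff m =
      m * (rootPoly z Finset.univ).coeff m := by
  rcases m with _ | m
  · simp
  · simp only [coeff_X_mul, sum_coeff_rootPoly_erase]; push_cast; ring

theorem sum_mul_coeff_rootPoly_erase (m : ℕ) :
    ∑ i, z i * (rootPoly z (Finset.univ.erase i)).coeff m =
      (m - Fintype.card ι) * (rootPoly z Finset.univ).coeff m := by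
  simp only [mul_coeff_rootPoly_erase, Finset.sum_sub_distrib, sum_coeff_X_mul_rootPoly_erase]
  simp
  ring

variable {z}

/-- Symmetrization of the double sum with `E_i - E_j = (z_i - z_j) ∏_{l ≠ i, j} (X - z_l)`, where
`E_i = ∏_{j ≠ i} (X - z_j)`. -/
theorem two_mul_sum_invSum_mul_rootPoly_erase (hz : Function.Injective z) :
    2 * ∑ i, C (invSum z (z i)) * rootPoly z (Finset.univ.erase i) =
      derivative (derivative (rootPoly z Finset.univ)) := by
  have h1 : derivative (derivative (rootPoly z Finset.univ)) =
      ∑ i, ∑ j, if j = i then 0 else rootPoly z ((Finset.univ.erase i).erase j) := by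
    rw [← sum_rootPoly_erase, derivative_sum]
    refine Finset.sum_congr rfl fun i _ => ?_
    rw [rootPoly, derivative_prod_finset, Finset.sum_ite, Finset.sum_const_zero, zero_add]
    refine Finset.sum_congr (by ext; simp) fun j _ => by simp [rootPoly]
  have h2 : ∑ i, C (invSum z (z i)) * rootPoly z (Finset.univ.erase i) =
      ∑ i, ∑ j, C (z i - z j)⁻¹ * rootPoly z (Finset.univ.erase i) := by
    simp only [invSum, map_sum, Finset.sum_mul]
  have h3 : ∑ i, ∑ j, C (z i - z j)⁻¹ * rootPoly z (Finset.univ.erase i) =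
      ∑ i, ∑ j, C (z j - z i)⁻¹ * rootPoly z (Finset.univ.erase j) := Finset.sum_comm
  have h4 : ∑ i, ∑ j, (C (z i - z j)⁻¹ * rootPoly z (Finset.univ.erase i) +
      C (z j - z i)⁻¹ * rootPoly z (Finset.univ.erase j)) =
      ∑ i, ∑ j, if j = i then 0 else rootPoly z ((Finset.univ.erase i).erase j) := by
    refine Finset.sum_congr rfl fun i _ => Finset.sum_congr rfl fun j _ => ?_
    split_ifs with h
    · simp [h]
    · have hne : z i - z j ≠ 0 := sub_ne_zero.2 fun e => h (hz e).symm
      rw [← rootPoly_erase_mul z (s := Finset.univ.erase i) (i := j) (by simp [h]),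
        ← rootPoly_erase_mul z (s := Finset.univ.erase j) (i := i) (by simp [Ne.symm h]),
        Finset.erase_right_comm (a := j), ← neg_sub (z i) (z j), inv_neg, C_neg]
      have : C (z i - z j)⁻¹ * (C (z i) - C (z j)) = 1 := by
        rw [← C_sub, ← C_mul, inv_mul_cancel₀ hne, C_1]
      linear_combination rootPoly z ((Finset.univ.erase i).erase j) * this
  simp only [Finset.sum_add_distrib] at h4
  rw [h1, h2, ← h4]
  linear_combination h3

theorem sum_sq_mul_invSum_mul_coeff (hz : Function.Injective z) (m : ℕ) :
    ∑ i, z i ^ 2 * invSum z (z i) * (rootPoly z (Finset.univ.erase i)).coeff m =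
      1 / 2 * ((m : ℂ) * (m - 1) - Fintype.card ι * (Fintype.card ι - 1)) *
        (rootPoly z Finset.univ).coeff m := by
  have h1 : ∀ i, C (z i ^ 2 * invSum z (z i)) * rootPoly z (Finset.univ.erase i) =
      X ^ 2 * (C (invSum z (z i)) * rootPoly z (Finset.univ.erase i)) -
        C (invSum z (z i)) * (X * rootPoly z Finset.univ) -
        C (z i * invSum z (z i)) * rootPoly z Finset.univ := by
    intro i
    simp only [C_mul, C_pow]
    linear_combination (C (z i) * C (invSum z (z i)) + X * C (invSum z (z i))) *
      C_mul_rootPoly_erase z i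
  have h2 : ∑ i, z i ^ 2 * invSum z (z i) * (rootPoly z (Finset.univ.erase i)).coeff m =
      (∑ i, C (z i ^ 2 * invSum z (z i)) * rootPoly z (Finset.univ.erase i)).coeff m := by
    simp only [finsetSum_coeff, coeff_C_mul]
  have h3 : (X ^ 2 * ∑ i, C (invSum z (z i)) * rootPoly z (Finset.univ.erase i)).coeff m =
      1 / 2 * ((m : ℂ) * (m - 1)) * (rootPoly z Finset.univ).coeff m := by
    have : ∑ i, C (invSum z (z i)) * rootPoly z (Finset.univ.erase i) =
        C (1 / 2) * derivative (derivative (rootPoly z Finset.univ)) := by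
      rw [← two_mul_sum_invSum_mul_rootPoly_erase hz, ← mul_assoc,
        show (2 : ℂ[X]) = C 2 from rfl, ← C_mul]
      norm_num
    rw [this]
    rcases m with _ | _ | m
    · simp
    · simp [coeff_X_pow_mul']
    · rw [coeff_X_pow_mul, coeff_C_mul, coeff_derivative, coeff_derivative]
      push_cast
      ring
  rw [h2]
  simp only [h1, Finset.sum_sub_distrib]
  rw [← Finset.mul_sum, ← Finset.sum_mul, ← Finset.sum_mul, ← map_sum, ← map_sum, sum_invSum_self,
    sum_mul_invSum hz, coeff_sub, coeff_sub, h3, C_0, zero_mul, coeff_zero, coeff_C_mul]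
  ring

/-- Bilinear sums over the coefficients of the polynomials with one root removed are triangular.
They obey the recursion obtained from moving the factor `z_i` in
`∑_i z_i E_i[m] E_i[n]`, `E_i = ∏_{j ≠ i} (X - z_j)`, from one coefficient to the other. -/
theorem sum_coeff_X_mul_mul_coeff_X_mul (z : ι → ℂ) (n m : ℕ) :
    ∑ i, (X * rootPoly z (Finset.univ.erase i)).coeff m *
        (X * rootPoly z (Finset.univ.erase i)).coeff n =
      n * ((rootPoly z Finset.univ).coeff m * (rootPoly z Finset.univ).coeff n) -
        ∑ l ∈ Finset.range n, ((m : ℂ) - n + 2 * (l + 1)) *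
          ((rootPoly z Finset.univ).coeff (m + (l + 1)) *
            (rootPoly z Finset.univ).coeff (n - (l + 1))) := by
  induction n generalizing m with
  | zero => simp
  | succ n ih =>
    set c := (rootPoly z Finset.univ).coeff with hc
    have h1 : ∀ i, (X * rootPoly z (Finset.univ.erase i)).coeff m *
        (X * rootPoly z (Finset.univ.erase i)).coeff (n + 1) =
        (X * rootPoly z (Finset.univ.erase i)).coeff (m + 1) *
          (X * rootPoly z (Finset.univ.erase i)).coeff n +
        c m * (rootPoly z (Finset.univ.erase i)).coeff n -
        c n * (rootPoly z (Finset.univ.erase i)).coeff m := by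
      intro i
      rw [coeff_X_mul, coeff_X_mul]
      linear_combination (rootPoly z (Finset.univ.erase i)).coeff m *
          mul_coeff_rootPoly_erase z i n -
        (rootPoly z (Finset.univ.erase i)).coeff n * mul_coeff_rootPoly_erase z i m
    simp only [h1, Finset.sum_sub_distrib, Finset.sum_add_distrib, ← Finset.mul_sum, ih,
      sum_coeff_rootPoly_erase]
    rw [Finset.sum_range_succ']
    have h2 : ∀ l, ((m : ℂ) - ((n + 1 : ℕ) : ℂ) + 2 * (((l + 1 : ℕ) : ℂ) + 1)) *
        (c (m + (l + 1 + 1)) * c (n + 1 - (l + 1 + 1))) =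
        (((m + 1 : ℕ) : ℂ) - n + 2 * (l + 1)) * (c (m + 1 + (l + 1)) * c (n - (l + 1))) := by
      intro l
      rw [show m + (l + 1 + 1) = m + 1 + (l + 1) by ring,
        show n + 1 - (l + 1 + 1) = n - (l + 1) by omega]
      push_cast
      ring
    simp only [h2]
    simp only [zero_add, Nat.add_sub_cancel]
    push_cast
    ring

theorem sum_sq_mul_coeff_mul_coeff (z : ι → ℂ) (m n : ℕ) :
    ∑ i, z i ^ 2 * ((rootPoly z (Finset.univ.erase i)).coeff m *
        (rootPoly z (Finset.univ.erase i)).coeff n) =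
      (Fintype.card ι - m) *
          ((rootPoly z Finset.univ).coeff m * (rootPoly z Finset.univ).coeff n) -
        ∑ l ∈ Finset.range n, ((m : ℂ) - n + 2 * (l + 1)) *
          ((rootPoly z Finset.univ).coeff (m + (l + 1)) *
            (rootPoly z Finset.univ).coeff (n - (l + 1))) := by
  set c := (rootPoly z Finset.univ).coeff with hc
  have h1 : ∀ i, z i ^ 2 * ((rootPoly z (Finset.univ.erase i)).coeff m *
      (rootPoly z (Finset.univ.erase i)).coeff n) =
      (X * rootPoly z (Finset.univ.erase i)).coeff m *
        (X * rootPoly z (Finset.univ.erase i)).coeff n -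
      c m * (X * rootPoly z (Finset.univ.erase i)).coeff n -
      c n * (X * rootPoly z (Finset.univ.erase i)).coeff m + c m * c n := by
    intro i
    calc _ = (z i * (rootPoly z (Finset.univ.erase i)).coeff m) *
        (z i * (rootPoly z (Finset.univ.erase i)).coeff n) := by ring
      _ = _ := by rw [mul_coeff_rootPoly_erase, mul_coeff_rootPoly_erase]; ring
  simp only [h1, Finset.sum_sub_distrib, Finset.sum_add_distrib, ← Finset.mul_sum,
    sum_coeff_X_mul_rootPoly_erase, sum_coeff_X_mul_mul_coeff_X_mul]
  rw [← hc]
  simp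
  ring

end coefficients

/-! ### The effective differential operator -/

section local_terms

variable {ι κ : Type*} [Fintype ι] [Fintype κ] {z : ι → ℂ} {w : κ → ℂ}

/-- The contribution of one blue particle at `x`, where `f₀`, `f₁`, `f₂` are the value and the
first two derivatives of the cofactor of `Ψ₀` with respect to `x`, and `a`, `a'` (`b`, `b'`) are the
inverse and inverse square sums over the other blue (the red) particles. The first two summands are
the hopping term without its multiple `(N² - 1) / 12` of the wave function, the last one is the
exchange with the red particles. -/
noncomputable def blueTerm (N x a a' b b' f₀ f₁ f₂ : ℂ) : ℂ :=
  -(N - 1) / 2 * (f₀ + x * (f₁ + f₀ * (2 * a + b))) +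
    1 / 2 * (2 * x * (f₁ + f₀ * (2 * a + b)) +
      x ^ 2 * (f₂ + 2 * f₁ * (2 * a + b) + f₀ * ((2 * a + b) ^ 2 - 2 * a' - b'))) +
    1 / 2 * x * (2 * (a * f₀ + f₁) + x * ((a ^ 2 - a') * f₀ + 2 * a * f₁ + f₂) -
      2 * b * (f₀ + x * (a * f₀ + f₁)) + x * f₀ * (b ^ 2 + b'))

/-- The hopping contribution of one red particle at `x`, without the multiple `(N² - 1) / 12` of the
wave function. The cofactor of `Ψ₀` does not depend on the red coordinates. -/
noncomputable def redTerm (N x a a' b b' : ℂ) : ℂ :=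
  -(N - 1) / 2 * (1 + x * (2 * b + a)) +
    1 / 2 * (2 * x * (2 * b + a) + x ^ 2 * ((2 * b + a) ^ 2 - 2 * b' - a'))

/-- The constant left over when the two- and three-particle terms are summed. -/
noncomputable def pairConstant (N A B : ℂ) : ℂ :=
  2 * (A * (A - 1)) + 5 / 6 * (A * (A - 1) * (A - 2)) + 3 / 2 * (B * (B - 1)) +
    2 / 3 * (B * (B - 1) * (B - 2)) + A * B + A * (A - 1) / 2 * B + A * B * (B - 1) -
    (N - 1) / 2 * (A ^ 2 + B ^ 2 + A * B)

theorem sum_blueTerm_add_sum_redTerm (hz : Function.Injective z) (hw : Function.Injective w)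
    (h : ∀ i k, z i ≠ w k) (N f₀ : ℂ) (f₁ f₂ : ι → ℂ) :
    ∑ i, blueTerm N (z i) (invSum z (z i)) (invSqSum z (z i)) (invSum w (z i)) (invSqSum w (z i))
          f₀ (f₁ i) (f₂ i) +
        f₀ * ∑ k, redTerm N (w k) (invSum z (w k)) (invSqSum z (w k)) (invSum w (w k))
          (invSqSum w (w k)) +
        f₀ * (∑ i, ∑ j, -(z i * z j) / (z i - z j) ^ 2 + ∑ k, ∑ l, -(w k * w l) / (w k - w l) ^ 2 +
          ∑ i, ∑ k, -(z i * w k) / (z i - w k) ^ 2) =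
      ∑ i, z i ^ 2 * f₂ i + 3 * ∑ i, z i ^ 2 * invSum z (z i) * f₁ i +
        (2 - (N - 1) / 2) * ∑ i, z i * f₁ i +
        pairConstant N (Fintype.card ι) (Fintype.card κ) * f₀ := by
  have h' : ∀ k i, w k ≠ z i := fun k i e => h i k e.symm
  have hb : ∀ i, blueTerm N (z i) (invSum z (z i)) (invSqSum z (z i)) (invSum w (z i))
      (invSqSum w (z i)) f₀ (f₁ i) (f₂ i) =
      z i ^ 2 * f₂ i + 3 * (z i ^ 2 * invSum z (z i) * f₁ i) + (2 - (N - 1) / 2) * (z i * f₁ i) +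
      f₀ * ((3 - (N - 1)) * (z i * invSum z (z i)) - (N - 1) / 2 * (z i * invSum w (z i)) +
        5 / 2 * (z i ^ 2 * (invSum z (z i) ^ 2 - invSqSum z (z i))) + z i ^ 2 * invSqSum z (z i) +
        z i ^ 2 * (invSum z (z i) * invSum w (z i)) +
        z i ^ 2 * (invSum w (z i) ^ 2 - invSqSum w (z i)) + z i ^ 2 * invSqSum w (z i) -
        (N - 1) / 2) := by
    intro i; unfold blueTerm; ring
  have hr : ∀ k, redTerm N (w k) (invSum z (w k)) (invSqSum z (w k)) (invSum w (w k))
      (invSqSum w (w k)) =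
      (2 - (N - 1)) * (w k * invSum w (w k)) + (1 - (N - 1) / 2) * (w k * invSum z (w k)) +
      2 * (w k ^ 2 * (invSum w (w k) ^ 2 - invSqSum w (w k))) + w k ^ 2 * invSqSum w (w k) +
      2 * (w k ^ 2 * (invSum w (w k) * invSum z (w k))) +
      1 / 2 * (w k ^ 2 * (invSum z (w k) ^ 2 - invSqSum z (w k))) - (N - 1) / 2 := by
    intro k; unfold redTerm; ring
  simp only [hb, hr, Finset.sum_add_distrib, Finset.sum_sub_distrib, ← Finset.mul_sum,
    Finset.sum_const, Finset.card_univ, nsmul_eq_mul]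
  have e1 := sum_mul_invSum hz
  have e2 := sum_mul_invSum hw
  have e3 := sum_mul_invSum_add h
  have e4 := sum_sq_mul_invSqSum hz
  have e5 := sum_sq_mul_invSqSum hw
  have e6 := sum_sq_mul_invSqSum_add h
  have e7 := sum_sq_mul_invSum_sq hz
  have e8 := sum_sq_mul_invSum_sq hw
  have e9 := sum_sq_mul_invSum_mul_invSum hz h
  have e10 := sum_sq_mul_invSum_mul_invSum hw h'
  unfold pairConstant
  linear_combination f₀ * (3 - (N - 1)) * e1 + f₀ * (2 - (N - 1)) * e2 +
    f₀ * (1 - (N - 1) / 2) * e3 + f₀ * e4 + f₀ * e5 + f₀ * e6 + 5 / 2 * f₀ * e7 + 2 * f₀ * e8 +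
    f₀ * e9 + 2 * f₀ * e10

end local_terms

/-! ### The momentum states as polynomials -/

section wave

open Polynomial

/-- Discrete Fourier transform on the lattice extracts coefficients. -/
theorem sum_star_site_pow_mul_eval {N : ℕ} (p : ℂ[X]) (hp : p.natDegree < N) {m : ℕ} (hm : m < N) :
    ∑ γ : Fin N, star (site N γ) ^ m * p.eval (site N γ) = N * p.coeff m := by
  have h1 : ∀ s < N, ∑ γ : Fin N, star (site N γ) ^ m * site N γ ^ s =
      if s = m then (N : ℂ) else 0 := by
    intro s hs
    have h2 : ∀ γ : Fin N, star (site N γ) ^ m * site N γ ^ s = site N γ ^ (N - m + s) := by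
      intro γ
      have h3 : star (site N γ) ^ m = site N γ ^ (N - m) := by
        rw [star_site, inv_pow]
        refine inv_eq_of_mul_eq_one_left ?_
        rw [← pow_add, Nat.sub_add_cancel hm.le, site_pow_card]
      rw [h3, ← pow_add]
    simp only [h2]
    rcases lt_trichotomy s m with h | h | h
    · rw [if_neg h.ne, sum_site_pow (by omega) (by omega)]
    · subst h
      simp [Nat.sub_add_cancel hm.le, site_pow_card]
    · rw [if_neg h.ne', ← sum_site_pow (N := N) (s := s - m) (by omega) (by omega)]
      refine Finset.sum_congr rfl fun γ _ => ?_
      rw [show N - m + s = N + (s - m) by omega, pow_add, site_pow_card, one_mul]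
  simp only [eval_eq_sum_range' hp, Finset.mul_sum]
  rw [Finset.sum_comm]
  have h4 : ∀ s ∈ Finset.range N, ∑ γ : Fin N, star (site N γ) ^ m * (p.coeff s * site N γ ^ s) =
      if s = m then (N : ℂ) * p.coeff m else 0 := by
    intro s hs
    rw [Finset.sum_congr rfl fun γ _ => mul_left_comm _ _ _, ← Finset.mul_sum,
      h1 s (Finset.mem_range.1 hs)]
    split_ifs with h
    · rw [h, mul_comm]
    · simp
  rw [Finset.sum_congr rfl h4]
  simp [hm]

/-- `Ψ_mn` is the product of two coefficients of `∏_i (X - z_i)` and `Ψ₀`. -/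
theorem psiMomentum_eq {N M₁ M₂ m n : ℕ} (hM : M₁ < N) (hm : m < N) (hn : n < N)
    (z : Fin M₁ → ℂ) (w : Fin M₂ → ℂ) :
    psiMomentum N M₁ M₂ m n z w =
      (rootPoly z Finset.univ).coeff m * (rootPoly z Finset.univ).coeff n * psiZero M₁ M₂ z w := by
  have hN : (N : ℂ) ≠ 0 := by exact_mod_cast (by omega : N ≠ 0)
  have hd : (rootPoly z Finset.univ).natDegree < N := by simpa [natDegree_rootPoly] using hM
  have h1 : ∀ γ δ : Fin N, star (site N γ) ^ m * star (site N δ) ^ n *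
      psiLocalized N M₁ M₂ γ δ z w =
      (star (site N γ) ^ m * (rootPoly z Finset.univ).eval (site N γ)) *
        (star (site N δ) ^ n * (rootPoly z Finset.univ).eval (site N δ)) * psiZero M₁ M₂ z w := by
    intro γ δ
    rw [psiLocalized, eval_rootPoly, eval_rootPoly, Finset.prod_mul_distrib]
    ring
  simp only [psiMomentum, h1, ← Finset.sum_mul, ← Finset.mul_sum,
    sum_star_site_pow_mul_eval _ hd hm, sum_star_site_pow_mul_eval _ hd hn]
  field_simp

/-- `∏_{i<j} (v_i - v_j)²`. -/
noncomputable def vandSq {M : ℕ} (v : Fin M → ℂ) : ℂ := ∏ i, ∏ j ∈ Finset.Ioi i, (v i - v j) ^ 2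

/-- The factors of `vandSq` without `v_i`. -/
noncomputable def vandSqErase {M : ℕ} (v : Fin M → ℂ) (i : Fin M) : ℂ :=
  ∏ j ∈ Finset.univ.erase i, ∏ l ∈ (Finset.Ioi j).erase i, (v j - v l) ^ 2

theorem vandSq_comp_perm {M : ℕ} (v : Fin M → ℂ) (σ : Equiv.Perm (Fin M)) :
    vandSq (v ∘ σ) = vandSq v := by
  have h : ∀ u : Fin M → ℂ, vandSq u = (Matrix.vandermonde u).det ^ 2 := by
    intro u
    simp only [vandSq, Matrix.det_vandermonde, ← Finset.prod_pow]
    exact Finset.prod_congr rfl fun i _ => Finset.prod_congr rfl fun j _ => by ring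
  have h2 : Matrix.vandermonde (v ∘ σ) = (Matrix.vandermonde v).submatrix σ id := rfl
  rw [h, h, h2, Matrix.det_permute, mul_pow]
  rcases Int.units_eq_one_or (Equiv.Perm.sign σ) with hs | hs <;> simp [hs]

theorem vandSq_eq {M : ℕ} (v : Fin M → ℂ) (i : Fin M) :
    vandSq v = (rootPoly v (Finset.univ.erase i)).eval (v i) ^ 2 * vandSqErase v i := by
  have h1 : (rootPoly v (Finset.univ.erase i)).eval (v i) ^ 2 =
      (∏ j ∈ Finset.Ioi i, (v i - v j) ^ 2) *
        ∏ j ∈ Finset.univ.erase i, if i ∈ Finset.Ioi j then (v j - v i) ^ 2 else 1 := by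
    rw [eval_rootPoly, ← Finset.prod_pow, ← Finset.prod_filter]
    rw [← Finset.prod_filter_mul_prod_filter_not (Finset.univ.erase i) (fun j => i < j)]
    congr 1
    · exact Finset.prod_congr (by ext j; simp; exact ne_of_gt) fun _ _ => rfl
    · refine Finset.prod_congr ?_ fun _ _ => by ring
      ext j
      simp only [Finset.mem_filter, Finset.mem_erase, Finset.mem_univ, and_true, not_lt,
        Finset.mem_Ioi]
      exact ⟨fun h => ⟨h.1, lt_of_le_of_ne h.2 h.1⟩, fun h => ⟨h.1, h.2.le⟩⟩
  rw [h1, vandSqErase, mul_assoc, ← Finset.prod_mul_distrib, vandSq,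
    ← Finset.mul_prod_erase _ _ (Finset.mem_univ i)]
  congr 1
  refine Finset.prod_congr rfl fun j _ => ?_
  split_ifs with h
  · exact (Finset.mul_prod_erase _ _ h).symm
  · rw [one_mul, Finset.erase_eq_of_notMem h]

theorem rootPoly_update_erase {ι : Type*} [Fintype ι] [DecidableEq ι] (v : ι → ℂ) (i : ι) (x : ℂ) :
    rootPoly (Function.update v i x) (Finset.univ.erase i) = rootPoly v (Finset.univ.erase i) :=
  Finset.prod_congr rfl fun j hj => by rw [Function.update_of_ne (Finset.ne_of_mem_erase hj)]

theorem rootPoly_update {ι : Type*} [Fintype ι] [DecidableEq ι] (v : ι → ℂ) (i : ι) (x : ℂ) :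
    rootPoly (Function.update v i x) Finset.univ =
      (X - C x) * rootPoly v (Finset.univ.erase i) := by
  rw [← rootPoly_erase_mul _ (Finset.mem_univ i), rootPoly_update_erase, Function.update_self]

theorem vandSqErase_update {M : ℕ} (v : Fin M → ℂ) (i : Fin M) (x : ℂ) :
    vandSqErase (Function.update v i x) i = vandSqErase v i :=
  Finset.prod_congr rfl fun j hj => Finset.prod_congr rfl fun l hl => by
    rw [Function.update_of_ne (Finset.ne_of_mem_erase hj),
      Function.update_of_ne (Finset.ne_of_mem_erase hl)]

theorem vandSq_update {M : ℕ} (v : Fin M → ℂ) (i : Fin M) (x : ℂ) :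
    vandSq (Function.update v i x) =
      (rootPoly v (Finset.univ.erase i)).eval x ^ 2 * vandSqErase v i := by
  rw [vandSq_eq _ i, rootPoly_update_erase, Function.update_self, vandSqErase_update]

theorem prod_update {ι : Type*} [Fintype ι] [DecidableEq ι] (v : ι → ℂ) (i : ι) (x : ℂ)
    (f : ℂ → ℂ) :
    ∏ j, f (Function.update v i x j) = f x * ∏ j ∈ Finset.univ.erase i, f (v j) := by
  rw [← Finset.mul_prod_erase _ _ (Finset.mem_univ i), Function.update_self]
  congr 1
  exact Finset.prod_congr rfl fun j hj => by rw [Function.update_of_ne (Finset.ne_of_mem_erase hj)]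

variable {M₁ M₂ : ℕ}

theorem psiZero_eq (z : Fin M₁ → ℂ) (w : Fin M₂ → ℂ) :
    psiZero M₁ M₂ z w =
      vandSq z * vandSq w * (∏ i, ∏ k, (z i - w k)) * (∏ i, z i) * ∏ k, w k := rfl

theorem psiZero_isSymmetric : IsSymmetric (psiZero M₁ M₂) where
  left σ z w := by
    have h1 : ∏ i, ∏ k, ((z ∘ σ) i - w k) = ∏ i, ∏ k, (z i - w k) :=
      Equiv.prod_comp σ fun i => ∏ k, (z i - w k)
    have h2 : ∏ i, (z ∘ σ) i = ∏ i, z i := Equiv.prod_comp σ z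
    rw [psiZero_eq, psiZero_eq, vandSq_comp_perm, h1, h2]
  right σ z w := by
    have h1 : ∏ i, ∏ k, (z i - (w ∘ σ) k) = ∏ i, ∏ k, (z i - w k) :=
      Finset.prod_congr rfl fun i _ => Equiv.prod_comp σ fun k => z i - w k
    have h2 : ∏ k, (w ∘ σ) k = ∏ k, w k := Equiv.prod_comp σ w
    rw [psiZero_eq, psiZero_eq, vandSq_comp_perm, h1, h2]

theorem psiMomentum_isSymmetric {N m n : ℕ} (hM : M₁ < N) (hm : m < N) (hn : n < N) :
    IsSymmetric (psiMomentum N M₁ M₂ m n) where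
  left σ z w := by
    have : rootPoly (z ∘ σ) Finset.univ = rootPoly z Finset.univ :=
      Equiv.prod_comp σ fun i => X - C (z i)
    rw [psiMomentum_eq hM hm hn, psiMomentum_eq hM hm hn, psiZero_isSymmetric.left, this]
  right σ z w := by
    rw [psiMomentum_eq hM hm hn, psiMomentum_eq hM hm hn, psiZero_isSymmetric.right]

theorem psiZero_ne_zero {z : Fin M₁ → ℂ} {w : Fin M₂ → ℂ} (hz : Function.Injective z)
    (hw : Function.Injective w) (h : ∀ i k, z i ≠ w k) (hz0 : ∀ i, z i ≠ 0) (hw0 : ∀ k, w k ≠ 0) :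
    psiZero M₁ M₂ z w ≠ 0 := by
  have hv : ∀ {M : ℕ} {v : Fin M → ℂ}, Function.Injective v → vandSq v ≠ 0 := by
    intro M v hv
    refine Finset.prod_ne_zero_iff.2 fun i _ => Finset.prod_ne_zero_iff.2 fun j hj => ?_
    exact pow_ne_zero _ (sub_ne_zero.2 fun e => (Finset.mem_Ioi.1 hj).ne (hv e))
  rw [psiZero_eq]
  refine mul_ne_zero (mul_ne_zero (mul_ne_zero (mul_ne_zero (hv hz) (hv hw)) ?_) ?_) ?_
  · exact Finset.prod_ne_zero_iff.2 fun i _ => Finset.prod_ne_zero_iff.2 fun k _ =>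
      sub_ne_zero.2 (h i k)
  · exact Finset.prod_ne_zero_iff.2 fun i _ => hz0 i
  · exact Finset.prod_ne_zero_iff.2 fun k _ => hw0 k

/-- `Ψ₀` as a function of one blue coordinate. -/
theorem exists_psiZero_update_left (z : Fin M₁ → ℂ) (w : Fin M₂ → ℂ) (i : Fin M₁) :
    ∃ K : ℂ, ∀ y, psiZero M₁ M₂ (Function.update z i y) w =
      K * (y * ((rootPoly z (Finset.univ.erase i)).eval y *
        (rootPoly z (Finset.univ.erase i)).eval y) * (rootPoly w Finset.univ).eval y) := by
  refine ⟨vandSqErase z i * vandSq w * (∏ j ∈ Finset.univ.erase i, ∏ k, (z j - w k)) *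
    (∏ j ∈ Finset.univ.erase i, z j) * ∏ k, w k, fun y => ?_⟩
  rw [psiZero_eq, vandSq_update, prod_update z i y fun x => ∏ k, (x - w k),
    prod_update z i y fun x => x, eval_rootPoly w]
  ring

/-- `Ψ₀` as a function of one red coordinate. -/
theorem exists_psiZero_update_right (z : Fin M₁ → ℂ) (w : Fin M₂ → ℂ) (k : Fin M₂) :
    ∃ K : ℂ, ∀ x, psiZero M₁ M₂ z (Function.update w k x) =
      K * (x * ((rootPoly w (Finset.univ.erase k)).eval x *
        (rootPoly w (Finset.univ.erase k)).eval x) * (rootPoly z Finset.univ).eval x) := by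
  refine ⟨vandSq z * vandSqErase w k * (∏ i, ∏ l ∈ Finset.univ.erase k, (z i - w l)) *
    (∏ i, z i) * (∏ l ∈ Finset.univ.erase k, w l) * (-1) ^ M₁, fun x => ?_⟩
  have h1 : ∏ i, ∏ l, (z i - Function.update w k x l) =
      (-1) ^ M₁ * (rootPoly z Finset.univ).eval x *
        ∏ i, ∏ l ∈ Finset.univ.erase k, (z i - w l) := by
    have : ∀ i, ∏ l, (z i - Function.update w k x l) =
        (-1) * (x - z i) * ∏ l ∈ Finset.univ.erase k, (z i - w l) := by
      intro i
      rw [prod_update w k x fun y => z i - y]; ring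
    simp only [this, Finset.prod_mul_distrib, eval_rootPoly]
    simp
  rw [psiZero_eq, vandSq_update, h1, prod_update w k x fun x => x]
  ring

/-- `Ψ₀` as a function of one blue and one red coordinate. -/
theorem exists_psiZero_update_update (z : Fin M₁ → ℂ) (w : Fin M₂ → ℂ) (i : Fin M₁) (k : Fin M₂) :
    ∃ K : ℂ, ∀ y x, psiZero M₁ M₂ (Function.update z i y) (Function.update w k x) =
      K * (y * x * ((rootPoly z (Finset.univ.erase i)).eval y ^ 2 *
        (rootPoly w (Finset.univ.erase k)).eval x ^ 2 *
        (rootPoly w (Finset.univ.erase k)).eval y *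
        (rootPoly z (Finset.univ.erase i)).eval x * (y - x))) := by
  refine ⟨vandSqErase z i * vandSqErase w k *
    (∏ j ∈ Finset.univ.erase i, ∏ l ∈ Finset.univ.erase k, (z j - w l)) *
    (∏ j ∈ Finset.univ.erase i, z j) * (∏ l ∈ Finset.univ.erase k, w l) *
    (-1) ^ (Finset.univ.erase i).card, fun y x => ?_⟩
  have h1 : ∏ j ∈ Finset.univ.erase i, ∏ l, (z j - Function.update w k x l) =
      (-1) ^ (Finset.univ.erase i).card * (rootPoly z (Finset.univ.erase i)).eval x *
        ∏ j ∈ Finset.univ.erase i, ∏ l ∈ Finset.univ.erase k, (z j - w l) := by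
    have : ∀ i, ∏ l, (z i - Function.update w k x l) =
        (-1) * (x - z i) * ∏ l ∈ Finset.univ.erase k, (z i - w l) := by
      intro i
      rw [prod_update w k x fun y => z i - y]; ring
    simp only [this, Finset.prod_mul_distrib, eval_rootPoly]
    simp
  rw [psiZero_eq, vandSq_update, vandSq_update,
    prod_update z i y fun t => ∏ l, (t - Function.update w k x l), h1,
    prod_update w k x fun t => y - t, prod_update z i y fun x => x, prod_update w k x fun x => x,
    eval_rootPoly w _ y]
  ring

/-- Exchanging a blue and a red particle in `Ψ₀`. -/
theorem psiZero_exchange {z : Fin M₁ → ℂ} {w : Fin M₂ → ℂ} (hz : Function.Injective z)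
    (hw : Function.Injective w) (i : Fin M₁) (k : Fin M₂) :
    psiZero M₁ M₂ (Function.update z i (w k)) (Function.update w k (z i)) =
      -psiZero M₁ M₂ z w *
        ((rootPoly z (Finset.univ.erase i)).eval (w k) *
          (rootPoly w (Finset.univ.erase k)).eval (z i)) /
        ((rootPoly z (Finset.univ.erase i)).eval (z i) *
          (rootPoly w (Finset.univ.erase k)).eval (w k)) := by
  obtain ⟨K, hK⟩ := exists_psiZero_update_update z w i k
  have h0 := hK (z i) (w k)
  rw [Function.update_eq_self, Function.update_eq_self] at h0
  have h1 := eval_rootPoly_erase_self_ne_zero hz i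
  have h2 := eval_rootPoly_erase_self_ne_zero hw k
  rw [hK, h0]
  field_simp
  ring

end wave

/-! ### The Hamiltonian on the momentum states -/

section action

open Polynomial

variable {N M₁ M₂ : ℕ} {z : Fin M₁ → Fin N} {w : Fin M₂ → Fin N}

theorem sum_eq_sum_colors (h : IsPlacement z w) (F : Fin N → ℂ) :
    ∑ α, F α = ∑ i, F (z i) + ∑ k, F (w k) +
      ∑ α ∈ Finset.univ.filter (fun α => config z w α = green), F α := by
  rw [← Finset.sum_fiberwise Finset.univ (config z w) F, Fin.sum_univ_three]
  congr 2
  · have : Finset.univ.filter (fun α => config z w α = 0) = Finset.univ.image z := by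
      ext α
      simpa using (config_eq_blue (z := z) (w := w) (α := α))
    rw [this, Finset.sum_image fun _ _ _ _ e => h.inj_left e]
  · have : Finset.univ.filter (fun α => config z w α = 1) = Finset.univ.image w := by
      ext α
      simpa using (config_eq_red h (α := α))
    rw [this, Finset.sum_image fun _ _ _ _ e => h.inj_right e]

theorem sum_sum_eq_sum_colors (h : IsPlacement z w) (F : Fin N → Fin N → ℂ)
    (hF : ∀ α β, F α β = F β α) :
    ∑ α, ∑ β, F α β = ∑ i, ∑ j, F (z i) (z j) + ∑ k, ∑ l, F (w k) (w l) +
      ∑ α ∈ Finset.univ.filter (fun α => config z w α = green),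
        ∑ β ∈ Finset.univ.filter (fun α => config z w α = green), F α β +
      2 * ∑ i, ∑ k, F (z i) (w k) +
      2 * ∑ i, ∑ β ∈ Finset.univ.filter (fun α => config z w α = green), F (z i) β +
      2 * ∑ k, ∑ β ∈ Finset.univ.filter (fun α => config z w α = green), F (w k) β := by
  have e1 : ∑ k, ∑ i, F (w k) (z i) = ∑ i, ∑ k, F (z i) (w k) := by
    rw [Finset.sum_comm]; simp only [hF]
  have e2 : ∑ α ∈ Finset.univ.filter (fun α => config z w α = green), ∑ i, F α (z i) =
      ∑ i, ∑ β ∈ Finset.univ.filter (fun α => config z w α = green), F (z i) β := by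
    rw [Finset.sum_comm]
    exact Finset.sum_congr rfl fun _ _ => Finset.sum_congr rfl fun _ _ => hF _ _
  have e3 : ∑ α ∈ Finset.univ.filter (fun α => config z w α = green), ∑ k, F α (w k) =
      ∑ k, ∑ β ∈ Finset.univ.filter (fun α => config z w α = green), F (w k) β := by
    rw [Finset.sum_comm]
    exact Finset.sum_congr rfl fun _ _ => Finset.sum_congr rfl fun _ _ => hF _ _
  rw [sum_eq_sum_colors h fun α => ∑ β, F α β]
  simp only [fun α => sum_eq_sum_colors h (F α), Finset.sum_add_distrib]
  rw [e1, e2, e3]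
  ring

/-- The spin exchange acts on a state by moving particles to arbitrary sites and by exchanging blue
and red particles, if the wave function vanishes whenever two coordinates coincide. -/
theorem hamiltonian_ket_apply_config {Ψ : WaveFunction M₁ M₂} (hΨ : IsSymmetric Ψ)
    (h : IsPlacement z w)
    (h₁₁ : ∀ i j, i ≠ j → Ψ (Function.update (fun j => site N (z j)) i (site N (z j)))
      (fun k => site N (w k)) = 0)
    (h₁₂ : ∀ i k, Ψ (Function.update (fun j => site N (z j)) i (site N (w k)))
      (fun k => site N (w k)) = 0)
    (h₂₂ : ∀ k l, k ≠ l → Ψ (fun j => site N (z j))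
      (Function.update (fun k => site N (w k)) k (site N (w l))) = 0)
    (h₂₁ : ∀ k i, Ψ (fun j => site N (z j))
      (Function.update (fun k => site N (w k)) k (site N (z i))) = 0) :
    hamiltonian N (ket N Ψ) (config z w) = 2 * (Real.pi : ℂ) ^ 2 / (N : ℂ) ^ 2 *
      (∑ i, ∑ β, coupling (z i) β *
          Ψ (Function.update (fun j => site N (z j)) i (site N β)) (fun k => site N (w k)) +
        ∑ k, ∑ β, coupling (w k) β *
          Ψ (fun j => site N (z j)) (Function.update (fun k => site N (w k)) k (site N β)) +
        ∑ i, ∑ k, coupling (z i) (w k) *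
          Ψ (Function.update (fun j => site N (z j)) i (site N (w k)))
            (Function.update (fun l => site N (w l)) k (site N (z i))) +
        (∑ i, ∑ j, coupling (z i) (z j) + ∑ k, ∑ l, coupling (w k) (w l) +
          ∑ i, ∑ k, coupling (z i) (w k) +
          ((N : ℂ) / 3 - M₁ - M₂) * (((N : ℂ) ^ 2 - 1) / 12)) *
          Ψ (fun j => site N (z j)) (fun k => site N (w k))) := by
  set G := Finset.univ.filter (fun α => config z w α = green) with hG
  set ψ := Ψ (fun j => site N (z j)) (fun k => site N (w k)) with hψ
  have hket : ket N Ψ (config z w) = ψ := ket_apply_config hΨ h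
  have hbb : ∀ {α β}, config z w α = config z w β →
      coupling α β * ket N Ψ (config z w ∘ Equiv.swap α β) = coupling α β * ψ := by
    intro α β e; rw [comp_swap_of_eq e, hket]
  have s1 := sum_sum_eq_sum_colors h
    (fun α β => coupling α β * ket N Ψ (config z w ∘ Equiv.swap α β))
    (fun α β => by rw [coupling_comm, Equiv.swap_comm])
  have s2 := sum_sum_eq_sum_colors h coupling coupling_comm
  simp only [← hG] at s1 s2
  have t1 : ∑ i, ∑ j, coupling (z i) (z j) * ket N Ψ (config z w ∘ Equiv.swap (z i) (z j)) =
      (∑ i, ∑ j, coupling (z i) (z j)) * ψ := by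
    simp only [Finset.sum_mul]
    exact Finset.sum_congr rfl fun i _ => Finset.sum_congr rfl fun j _ =>
      hbb (by rw [config_left, config_left])
  have t2 : ∑ k, ∑ l, coupling (w k) (w l) * ket N Ψ (config z w ∘ Equiv.swap (w k) (w l)) =
      (∑ k, ∑ l, coupling (w k) (w l)) * ψ := by
    simp only [Finset.sum_mul]
    exact Finset.sum_congr rfl fun i _ => Finset.sum_congr rfl fun j _ =>
      hbb (by rw [config_right h, config_right h])
  have t3 : ∑ α ∈ G, ∑ β ∈ G, coupling α β * ket N Ψ (config z w ∘ Equiv.swap α β) =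
      (∑ α ∈ G, ∑ β ∈ G, coupling α β) * ψ := by
    simp only [Finset.sum_mul]
    refine Finset.sum_congr rfl fun α hα => Finset.sum_congr rfl fun β hβ => hbb ?_
    rw [(Finset.mem_filter.1 hα).2, (Finset.mem_filter.1 hβ).2]
  have t4 : ∀ i, ∑ β ∈ G, coupling (z i) β * ket N Ψ (config z w ∘ Equiv.swap (z i) β) =
      ∑ β, coupling (z i) β *
        Ψ (Function.update (fun j => site N (z j)) i (site N β)) (fun k => site N (w k)) := by
    intro i
    rw [sum_eq_sum_colors h]
    have v1 : ∑ j, coupling (z i) (z j) *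
        Ψ (Function.update (fun j => site N (z j)) i (site N (z j)))
          (fun k => site N (w k)) = 0 := by
      refine Finset.sum_eq_zero fun j _ => ?_
      by_cases hij : i = j
      · rw [hij, coupling_self, zero_mul]
      · rw [h₁₁ i j hij, mul_zero]
    have v2 : ∑ k, coupling (z i) (w k) *
        Ψ (Function.update (fun j => site N (z j)) i (site N (w k))) (fun k => site N (w k)) = 0 :=
      Finset.sum_eq_zero fun k _ => by rw [h₁₂ i k, mul_zero]
    rw [v1, v2, zero_add, zero_add]
    refine Finset.sum_congr rfl fun β hβ => ?_
    rw [ket_exchange_left_green hΨ h i (Finset.mem_filter.1 hβ).2]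
  have t5 : ∀ k, ∑ β ∈ G, coupling (w k) β * ket N Ψ (config z w ∘ Equiv.swap (w k) β) =
      ∑ β, coupling (w k) β *
        Ψ (fun j => site N (z j)) (Function.update (fun k => site N (w k)) k (site N β)) := by
    intro k
    rw [sum_eq_sum_colors h]
    have v1 : ∑ i, coupling (w k) (z i) *
        Ψ (fun j => site N (z j)) (Function.update (fun k => site N (w k)) k (site N (z i))) = 0 :=
      Finset.sum_eq_zero fun i _ => by rw [h₂₁ k i, mul_zero]
    have v2 : ∑ l, coupling (w k) (w l) *
        Ψ (fun j => site N (z j))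
          (Function.update (fun k => site N (w k)) k (site N (w l))) = 0 := by
      refine Finset.sum_eq_zero fun l _ => ?_
      by_cases hkl : k = l
      · rw [hkl, coupling_self, zero_mul]
      · rw [h₂₂ k l hkl, mul_zero]
    rw [v1, v2, zero_add, zero_add]
    refine Finset.sum_congr rfl fun β hβ => ?_
    rw [ket_exchange_right_green hΨ h k (Finset.mem_filter.1 hβ).2]
  simp only [t4, t5, fun i k => ket_exchange_left_right hΨ h i k] at s1
  rw [t1, t2, t3] at s1
  have c1 : ∑ i, ∑ j, coupling (z i) (z j) + ∑ i, ∑ k, coupling (z i) (w k) +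
      ∑ i, ∑ β ∈ G, coupling (z i) β = M₁ * (((N : ℂ) ^ 2 - 1) / 12) := by
    rw [← Finset.sum_add_distrib, ← Finset.sum_add_distrib,
      Finset.sum_congr rfl fun i _ => (sum_eq_sum_colors h (coupling (z i))).symm]
    simp [sum_coupling]
  have c2 : ∑ k, ∑ i, coupling (w k) (z i) + ∑ k, ∑ l, coupling (w k) (w l) +
      ∑ k, ∑ β ∈ G, coupling (w k) β = M₂ * (((N : ℂ) ^ 2 - 1) / 12) := by
    rw [← Finset.sum_add_distrib, ← Finset.sum_add_distrib,
      Finset.sum_congr rfl fun k _ => (sum_eq_sum_colors h (coupling (w k))).symm]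
    simp [sum_coupling]
  have c3 : ∑ k, ∑ i, coupling (w k) (z i) = ∑ i, ∑ k, coupling (z i) (w k) := by
    rw [Finset.sum_comm]
    exact Finset.sum_congr rfl fun _ _ => Finset.sum_congr rfl fun _ _ => coupling_comm _ _
  have c4 : ∑ α, ∑ β : Fin N, coupling α β = N * (((N : ℂ) ^ 2 - 1) / 12) := by
    simp [sum_coupling]
  rw [c4] at s2
  rw [c3] at c2
  rw [hamiltonian_apply, hket, s1, c4]
  linear_combination (Real.pi : ℂ) ^ 2 / (N : ℂ) ^ 2 * ψ * (-2 * c1 - 2 * c2 - s2)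

/-- The product of two coefficients of `∏_j (X - z_j)` as a polynomial in `z_i`. -/
noncomputable def coeffPoly {ι : Type*} [Fintype ι] [DecidableEq ι] (z : ι → ℂ) (m n : ℕ) (i : ι) :
    ℂ[X] :=
  (C ((X * rootPoly z (Finset.univ.erase i)).coeff m) -
      C ((rootPoly z (Finset.univ.erase i)).coeff m) * X) *
    (C ((X * rootPoly z (Finset.univ.erase i)).coeff n) -
      C ((rootPoly z (Finset.univ.erase i)).coeff n) * X)

section coeffPoly

variable {ι : Type*} [Fintype ι] [DecidableEq ι] (z : ι → ℂ) (m n : ℕ) (i : ι)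

theorem natDegree_coeffPoly_le : (coeffPoly z m n i).natDegree ≤ 2 := by
  have h : ∀ a b : ℂ, (C a - C b * X).natDegree ≤ 1 := by
    intro a b
    compute_degree
  exact (natDegree_mul_le).trans (Nat.add_le_add (h _ _) (h _ _))

theorem eval_coeffPoly (y : ℂ) : (coeffPoly z m n i).eval y =
    (rootPoly (Function.update z i y) Finset.univ).coeff m *
      (rootPoly (Function.update z i y) Finset.univ).coeff n := by
  simp only [rootPoly_update, coeffPoly, sub_mul, coeff_sub, coeff_C_mul, eval_mul, eval_sub,
    eval_C, eval_X]
  ring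

theorem eval_coeffPoly_self : (coeffPoly z m n i).eval (z i) =
    (rootPoly z Finset.univ).coeff m * (rootPoly z Finset.univ).coeff n := by
  rw [eval_coeffPoly, Function.update_eq_self]

theorem eval_derivative_coeffPoly_self : (derivative (coeffPoly z m n i)).eval (z i) =
    -((rootPoly z (Finset.univ.erase i)).coeff m * (rootPoly z Finset.univ).coeff n +
      (rootPoly z Finset.univ).coeff m * (rootPoly z (Finset.univ.erase i)).coeff n) := by
  have h1 := mul_coeff_rootPoly_erase z i m
  have h2 := mul_coeff_rootPoly_erase z i n
  simp only [coeffPoly, derivative_mul, derivative_sub, derivative_C, derivative_X, eval_add,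
    eval_mul, eval_sub, eval_C, eval_X, zero_mul, zero_sub, mul_one, zero_add, eval_neg]
  linear_combination (rootPoly z (Finset.univ.erase i)).coeff m * h2 +
    (rootPoly z (Finset.univ.erase i)).coeff n * h1

theorem eval_derivative_derivative_coeffPoly_self :
    (derivative (derivative (coeffPoly z m n i))).eval (z i) =
      2 * ((rootPoly z (Finset.univ.erase i)).coeff m *
        (rootPoly z (Finset.univ.erase i)).coeff n) := by
  simp only [coeffPoly, derivative_mul, derivative_sub, derivative_add, derivative_neg,
    derivative_C, derivative_X, eval_add, eval_mul, eval_C, zero_mul, zero_sub, mul_one, zero_add,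
    eval_neg, mul_zero, add_zero, neg_zero]
  ring

end coeffPoly

/-- Moving one blue particle. -/
theorem sum_coupling_mul_update_left {Z : Fin M₁ → ℂ} {W : Fin M₂ → ℂ} (hM₁ : 3 * M₁ + 4 = N)
    (hM₂ : 3 * M₂ = N + 2) (hZ : Function.Injective Z) (hZW : ∀ i k, Z i ≠ W k) (i : Fin M₁)
    {α : Fin N} (hα : Z i = site N α) (Φ : ℂ[X]) (hΦ : Φ.natDegree ≤ 2) :
    ∑ β, coupling α β * (Φ.eval (site N β) * psiZero M₁ M₂ (Function.update Z i (site N β)) W) =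
      ((N : ℂ) ^ 2 - 1) / 12 * (Φ.eval (Z i) * psiZero M₁ M₂ Z W) +
      psiZero M₁ M₂ Z W *
        (-((N : ℂ) - 1) / 2 * (Φ.eval (Z i) + Z i * ((derivative Φ).eval (Z i) +
          Φ.eval (Z i) * (2 * invSum Z (Z i) + invSum W (Z i)))) +
        1 / 2 * (2 * Z i * ((derivative Φ).eval (Z i) +
          Φ.eval (Z i) * (2 * invSum Z (Z i) + invSum W (Z i))) +
          Z i ^ 2 * ((derivative (derivative Φ)).eval (Z i) +
            2 * (derivative Φ).eval (Z i) * (2 * invSum Z (Z i) + invSum W (Z i)) +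
            Φ.eval (Z i) * ((2 * invSum Z (Z i) + invSum W (Z i)) ^ 2 - 2 * invSqSum Z (Z i) -
              invSqSum W (Z i))))) := by
  obtain ⟨K, hK⟩ := exists_psiZero_update_left Z W i
  set A := rootPoly Z (Finset.univ.erase i) with hA
  set B := rootPoly W Finset.univ with hB
  obtain ⟨a1, a2⟩ := eval_derivative_rootPoly_erase hZ i
  obtain ⟨b1, b2⟩ := eval_derivative_rootPoly_univ (hZW i)
  rw [← hA] at a1 a2
  rw [← hB] at b1 b2
  set P : ℂ[X] := C K * (X * (A * A) * B) * Φ with hP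
  have hPeval : ∀ β, Φ.eval (site N β) * psiZero M₁ M₂ (Function.update Z i (site N β)) W =
      P.eval (site N β) := by
    intro β
    rw [hK, hP]
    simp only [eval_mul, eval_C, eval_X]
    ring
  have hdeg : P.natDegree < N := by
    have hi : 0 < M₁ := i.pos
    have hA' : A.natDegree = M₁ - 1 := by
      rw [hA, natDegree_rootPoly, Finset.card_erase_of_mem (Finset.mem_univ i)]; simp
    have hB' : B.natDegree = M₂ := by rw [hB, natDegree_rootPoly]; simp
    have h1 : (C K * (X * (A * A) * B)).natDegree ≤ 1 + ((M₁ - 1) + (M₁ - 1)) + M₂ := by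
      refine (natDegree_C_mul_le _ _).trans (natDegree_mul_le.trans ?_)
      rw [hB']
      refine Nat.add_le_add_right (natDegree_mul_le.trans ?_) _
      rw [natDegree_X]
      refine Nat.add_le_add_left (natDegree_mul_le.trans ?_) _
      rw [hA']
    have h2 : P.natDegree ≤ 1 + ((M₁ - 1) + (M₁ - 1)) + M₂ + 2 :=
      natDegree_mul_le.trans (Nat.add_le_add h1 hΦ)
    omega
  have h0 : psiZero M₁ M₂ Z W = K * (Z i * (A.eval (Z i) * A.eval (Z i)) * B.eval (Z i)) := by
    rw [← hK, Function.update_eq_self]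
  simp only [hPeval]
  rw [sum_coupling_mul_eval α P hdeg, ← hα, h0, hP]
  simp only [derivative_mul, derivative_add, derivative_C, derivative_X, eval_add, eval_mul, eval_C,
    eval_X, a1, a2, b1, b2, zero_mul, zero_add, one_mul]
  ring

/-- Moving one red particle. -/
theorem sum_coupling_mul_update_right {Z : Fin M₁ → ℂ} {W : Fin M₂ → ℂ} (hM₁ : 3 * M₁ + 4 = N)
    (hM₂ : 3 * M₂ = N + 2) (hW : Function.Injective W) (hZW : ∀ i k, Z i ≠ W k) (k : Fin M₂)
    {α : Fin N} (hα : W k = site N α) :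
    ∑ β, coupling α β * psiZero M₁ M₂ Z (Function.update W k (site N β)) =
      ((N : ℂ) ^ 2 - 1) / 12 * psiZero M₁ M₂ Z W +
      psiZero M₁ M₂ Z W * redTerm N (W k) (invSum Z (W k)) (invSqSum Z (W k)) (invSum W (W k))
        (invSqSum W (W k)) := by
  obtain ⟨K, hK⟩ := exists_psiZero_update_right Z W k
  set B := rootPoly W (Finset.univ.erase k) with hB
  set A := rootPoly Z Finset.univ with hA
  obtain ⟨b1, b2⟩ := eval_derivative_rootPoly_erase hW k
  obtain ⟨a1, a2⟩ := eval_derivative_rootPoly_univ (v := Z) (x := W k) fun i => (hZW i k).symm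
  rw [← hA] at a1 a2
  rw [← hB] at b1 b2
  set P : ℂ[X] := C K * (X * (B * B) * A) with hP
  have hPeval : ∀ β, psiZero M₁ M₂ Z (Function.update W k (site N β)) = P.eval (site N β) := by
    intro β
    rw [hK, hP]
    simp only [eval_mul, eval_C, eval_X]
  have hdeg : P.natDegree < N := by
    have hi : 0 < M₂ := k.pos
    have hB' : B.natDegree = M₂ - 1 := by
      rw [hB, natDegree_rootPoly, Finset.card_erase_of_mem (Finset.mem_univ k)]; simp
    have hA' : A.natDegree = M₁ := by rw [hA, natDegree_rootPoly]; simp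
    have h1 : P.natDegree ≤ 1 + ((M₂ - 1) + (M₂ - 1)) + M₁ := by
      refine (natDegree_C_mul_le _ _).trans (natDegree_mul_le.trans ?_)
      rw [hA']
      refine Nat.add_le_add_right (natDegree_mul_le.trans ?_) _
      rw [natDegree_X]
      refine Nat.add_le_add_left (natDegree_mul_le.trans ?_) _
      rw [hB']
    omega
  have h0 : psiZero M₁ M₂ Z W = K * (W k * (B.eval (W k) * B.eval (W k)) * A.eval (W k)) := by
    rw [← hK, Function.update_eq_self]
  simp only [hPeval]
  rw [sum_coupling_mul_eval α P hdeg, ← hα, h0, hP, redTerm]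
  simp only [derivative_mul, derivative_add, derivative_C, derivative_X, eval_add, eval_mul, eval_C,
    eval_X, a1, a2, b1, b2, zero_mul, zero_add, one_mul]
  ring

/-- Exchanging one blue particle with all red particles: the sum of residues turns the nonlocal
exchange into a differential operator. -/
theorem sum_coupling_mul_exchange {Z : Fin M₁ → ℂ} {W : Fin M₂ → ℂ} (hM : M₁ + 1 ≤ M₂)
    (hZ : Function.Injective Z) (hW : Function.Injective W) (hZW : ∀ i k, Z i ≠ W k) (i : Fin M₁)
    (Φ : ℂ[X]) (hΦ : Φ.natDegree ≤ 2) :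
    ∑ k, -(Z i * W k) / (Z i - W k) ^ 2 * (Φ.eval (W k) *
        psiZero M₁ M₂ (Function.update Z i (W k)) (Function.update W k (Z i))) =
      psiZero M₁ M₂ Z W *
        (1 / 2 * Z i * (2 * (invSum Z (Z i) * Φ.eval (Z i) + (derivative Φ).eval (Z i)) +
          Z i * ((invSum Z (Z i) ^ 2 - invSqSum Z (Z i)) * Φ.eval (Z i) +
            2 * invSum Z (Z i) * (derivative Φ).eval (Z i) +
            (derivative (derivative Φ)).eval (Z i)) -
          2 * invSum W (Z i) * (Φ.eval (Z i) + Z i * (invSum Z (Z i) * Φ.eval (Z i) +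
            (derivative Φ).eval (Z i))) +
          Z i * Φ.eval (Z i) * (invSum W (Z i) ^ 2 + invSqSum W (Z i)))) := by
  set A := rootPoly Z (Finset.univ.erase i) with hA
  set B := rootPoly W Finset.univ with hB
  obtain ⟨a1, a2⟩ := eval_derivative_rootPoly_erase hZ i
  rw [← hA] at a1 a2
  have hA0 : A.eval (Z i) ≠ 0 := eval_rootPoly_erase_self_ne_zero hZ i
  have hB0 : B.eval (Z i) ≠ 0 := eval_rootPoly_ne_zero fun k _ => hZW i k
  set P : ℂ[X] := X * A * Φ with hP
  have hdeg : P.natDegree ≤ Fintype.card (Fin M₂) + 1 := by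
    have hi : 0 < M₁ := i.pos
    have hA' : A.natDegree = M₁ - 1 := by
      rw [hA, natDegree_rootPoly, Finset.card_erase_of_mem (Finset.mem_univ i)]; simp
    have h1 : P.natDegree ≤ 1 + (M₁ - 1) + 2 := by
      refine natDegree_mul_le.trans (Nat.add_le_add (natDegree_mul_le.trans ?_) hΦ)
      rw [natDegree_X, hA']
    simp only [Fintype.card_fin]
    omega
  have hres := sum_residues hW (hZW i) P hdeg
  have hterm : ∀ k, -(Z i * W k) / (Z i - W k) ^ 2 * (Φ.eval (W k) *
      psiZero M₁ M₂ (Function.update Z i (W k)) (Function.update W k (Z i))) =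
      -(psiZero M₁ M₂ Z W * Z i * B.eval (Z i) / A.eval (Z i)) *
        (P.eval (W k) / ((rootPoly W (Finset.univ.erase k)).eval (W k) * (W k - Z i) ^ 3)) := by
    intro k
    have hk : Z i - W k ≠ 0 := sub_ne_zero.2 (hZW i k)
    have hBk : B.eval (Z i) = (Z i - W k) * (rootPoly W (Finset.univ.erase k)).eval (Z i) := by
      rw [hB, ← rootPoly_erase_mul W (Finset.mem_univ k)]; simp
    have hk0 := eval_rootPoly_erase_self_ne_zero hW k
    rw [psiZero_exchange hZ hW, hBk, hP, ← hA, ← neg_sub (Z i) (W k)]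
    simp only [eval_mul, eval_X]
    field_simp
  simp only [hterm]
  rw [← Finset.mul_sum, hres, ← hB, hP]
  simp only [derivative_mul, derivative_add, derivative_X, eval_add, eval_mul, eval_X, a1, a2,
    one_mul]
  field_simp
  ring

end action

section triangular

open Polynomial

variable {N M₁ M₂ : ℕ} {z : Fin M₁ → Fin N} {w : Fin M₂ → Fin N}

theorem ket_psiMomentum_config (hM : M₁ < N) {m n : ℕ} (hm : m < N) (hn : n < N)
    (h : IsPlacement z w) :
    ket N (psiMomentum N M₁ M₂ m n) (config z w) =
      (rootPoly (fun i => site N (z i)) Finset.univ).coeff m *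
        (rootPoly (fun i => site N (z i)) Finset.univ).coeff n *
        psiZero M₁ M₂ (fun i => site N (z i)) fun k => site N (w k) := by
  rw [ket_apply_config (psiMomentum_isSymmetric hM hm hn) h, psiMomentum_eq hM hm hn]

/-- The action of the Hamiltonian on the amplitudes of a momentum state. -/
theorem hamiltonian_ket_psiMomentum_config (hM₁ : 3 * M₁ + 4 = N) (hM₂ : 3 * M₂ = N + 2) {m n : ℕ}
    (hm : m < N) (hn : n < N) (h : IsPlacement z w) :
    hamiltonian N (ket N (psiMomentum N M₁ M₂ m n)) (config z w) =
      2 * (Real.pi : ℂ) ^ 2 / (N : ℂ) ^ 2 *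
          psiZero M₁ M₂ (fun i => site N (z i)) (fun k => site N (w k)) *
        ((((N : ℂ) * ((N : ℂ) ^ 2 - 1) / 36 + pairConstant N M₁ M₂ + 2 * (M₁ - m) +
            (2 - ((N : ℂ) - 1) / 2) * ((M₁ - m) + (M₁ - n)) +
            3 / 2 * ((M₁ * (M₁ - 1) - m * (m - 1)) + (M₁ * (M₁ - 1) - n * (n - 1)))) *
          ((rootPoly (fun i => site N (z i)) Finset.univ).coeff m *
            (rootPoly (fun i => site N (z i)) Finset.univ).coeff n)) -
        2 * ∑ l ∈ Finset.range n, ((m : ℂ) - n + 2 * (l + 1)) *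
          ((rootPoly (fun i => site N (z i)) Finset.univ).coeff (m + (l + 1)) *
            (rootPoly (fun i => site N (z i)) Finset.univ).coeff (n - (l + 1)))) := by
  have hM : M₁ < N := by omega
  set Z : Fin M₁ → ℂ := fun i => site N (z i) with hZdef
  set W : Fin M₂ → ℂ := fun k => site N (w k) with hWdef
  have hZ : Function.Injective Z := site_injective.comp h.inj_left
  have hW : Function.Injective W := site_injective.comp h.inj_right
  have hZW : ∀ i k, Z i ≠ W k := fun i k e => h.disj i k (site_injective e)
  set c := (rootPoly Z Finset.univ).coeff with hc
  set e : Fin M₁ → ℕ → ℂ := fun i => (rootPoly Z (Finset.univ.erase i)).coeff with he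
  set ψ₀ := psiZero M₁ M₂ Z W with hψ₀
  have hL : ∀ i y W', psiMomentum N M₁ M₂ m n (Function.update Z i y) W' =
      (coeffPoly Z m n i).eval y * psiZero M₁ M₂ (Function.update Z i y) W' := fun i y W' => by
    rw [psiMomentum_eq hM hm hn, eval_coeffPoly]
  have hR : ∀ W', psiMomentum N M₁ M₂ m n Z W' = c m * c n * psiZero M₁ M₂ Z W' :=
    fun W' => psiMomentum_eq hM hm hn _ _
  have z₁₁ : ∀ i j, i ≠ j → psiMomentum N M₁ M₂ m n (Function.update Z i (Z j)) W = 0 := by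
    intro i j hij
    obtain ⟨K, hK⟩ := exists_psiZero_update_left Z W i
    rw [hL, hK, eval_rootPoly_eq_zero (v := Z) (i := j) (by simp [hij.symm])]
    ring
  have z₁₂ : ∀ i k, psiMomentum N M₁ M₂ m n (Function.update Z i (W k)) W = 0 := by
    intro i k
    obtain ⟨K, hK⟩ := exists_psiZero_update_left Z W i
    rw [hL, hK, eval_rootPoly_eq_zero (v := W) (i := k) (by simp)]
    ring
  have z₂₂ : ∀ k l, k ≠ l → psiMomentum N M₁ M₂ m n Z (Function.update W k (W l)) = 0 := by
    intro k l hkl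
    obtain ⟨K, hK⟩ := exists_psiZero_update_right Z W k
    rw [hR, hK, eval_rootPoly_eq_zero (v := W) (i := l) (by simp [hkl.symm])]
    ring
  have z₂₁ : ∀ k i, psiMomentum N M₁ M₂ m n Z (Function.update W k (Z i)) = 0 := by
    intro k i
    obtain ⟨K, hK⟩ := exists_psiZero_update_right Z W k
    rw [hR, hK, eval_rootPoly_eq_zero (v := Z) (i := i) (by simp)]
    ring
  rw [hamiltonian_ket_apply_config (psiMomentum_isSymmetric hM hm hn) h z₁₁ z₁₂ z₂₂ z₂₁]
  have hop₁ : ∑ i, ∑ β, coupling (z i) β *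
        psiMomentum N M₁ M₂ m n (Function.update Z i (site N β)) W +
      ∑ i, ∑ k, coupling (z i) (w k) *
        psiMomentum N M₁ M₂ m n (Function.update Z i (W k)) (Function.update W k (Z i)) =
      M₁ * (((N : ℂ) ^ 2 - 1) / 12 * (c m * c n * ψ₀)) +
      ψ₀ * ∑ i, blueTerm N (Z i) (invSum Z (Z i)) (invSqSum Z (Z i)) (invSum W (Z i))
        (invSqSum W (Z i)) (c m * c n) (-(e i m * c n + c m * e i n)) (2 * (e i m * e i n)) := by
    have hconst : (M₁ : ℂ) * (((N : ℂ) ^ 2 - 1) / 12 * (c m * c n * ψ₀)) =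
        ∑ i : Fin M₁, ((N : ℂ) ^ 2 - 1) / 12 * (c m * c n * ψ₀) := by simp
    rw [hconst, Finset.mul_sum, ← Finset.sum_add_distrib, ← Finset.sum_add_distrib]
    refine Finset.sum_congr rfl fun i _ => ?_
    have h1 := sum_coupling_mul_update_left hM₁ hM₂ hZ hZW i (α := z i) rfl (coeffPoly Z m n i)
      (natDegree_coeffPoly_le _ _ _ _)
    have h2 := sum_coupling_mul_exchange (by omega) hZ hW hZW i (coeffPoly Z m n i)
      (natDegree_coeffPoly_le _ _ _ _)
    simp only [eval_coeffPoly_self, eval_derivative_coeffPoly_self,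
      eval_derivative_derivative_coeffPoly_self] at h1 h2
    simp only [hL, coupling_eq (z i) (w _)]
    rw [h1, h2, blueTerm]
    ring
  have hop₂ : ∑ k, ∑ β, coupling (w k) β *
        psiMomentum N M₁ M₂ m n Z (Function.update W k (site N β)) =
      M₂ * (((N : ℂ) ^ 2 - 1) / 12 * (c m * c n * ψ₀)) +
      ψ₀ * (c m * c n * ∑ k, redTerm N (W k) (invSum Z (W k)) (invSqSum Z (W k)) (invSum W (W k))
        (invSqSum W (W k))) := by
    have hconst : (M₂ : ℂ) * (((N : ℂ) ^ 2 - 1) / 12 * (c m * c n * ψ₀)) =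
        ∑ k : Fin M₂, ((N : ℂ) ^ 2 - 1) / 12 * (c m * c n * ψ₀) := by simp
    rw [hconst, Finset.mul_sum, Finset.mul_sum, ← Finset.sum_add_distrib]
    refine Finset.sum_congr rfl fun k _ => ?_
    have h1 := sum_coupling_mul_update_right hM₁ hM₂ hW hZW k (α := w k) rfl
    have h2 : ∀ β, coupling (w k) β * psiMomentum N M₁ M₂ m n Z (Function.update W k (site N β)) =
        c m * c n * (coupling (w k) β * psiZero M₁ M₂ Z (Function.update W k (site N β))) := by
      intro β; rw [hR]; ring
    simp only [h2]
    rw [← Finset.mul_sum, h1]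
    ring
  have hsum := sum_blueTerm_add_sum_redTerm hZ hW hZW N (c m * c n)
    (fun i => -(e i m * c n + c m * e i n)) (fun i => 2 * (e i m * e i n))
  have g₁ : ∑ i, ∑ j, coupling (z i) (z j) = ∑ i, ∑ j, -(Z i * Z j) / (Z i - Z j) ^ 2 := by
    simp only [coupling_eq, hZdef]
  have g₂ : ∑ k, ∑ l, coupling (w k) (w l) = ∑ k, ∑ l, -(W k * W l) / (W k - W l) ^ 2 := by
    simp only [coupling_eq, hWdef]
  have g₃ : ∑ i, ∑ k, coupling (z i) (w k) = ∑ i, ∑ k, -(Z i * W k) / (Z i - W k) ^ 2 := by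
    simp only [coupling_eq, hZdef, hWdef]
  have d₁ : ∑ i, Z i * -(e i m * c n + c m * e i n) =
      ((M₁ - m) + (M₁ - n)) * (c m * c n) := by
    have h1 := sum_mul_coeff_rootPoly_erase Z m
    have h2 := sum_mul_coeff_rootPoly_erase Z n
    rw [Fintype.card_fin] at h1 h2
    have : ∀ i, Z i * -(e i m * c n + c m * e i n) =
        -(Z i * e i m) * c n + -(Z i * e i n) * c m := fun i => by ring
    simp only [this, Finset.sum_add_distrib, ← Finset.sum_mul, Finset.sum_neg_distrib]
    linear_combination -c n * h1 - c m * h2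
  have d₂ : ∑ i, Z i ^ 2 * invSum Z (Z i) * -(e i m * c n + c m * e i n) =
      1 / 2 * ((M₁ * (M₁ - 1) - m * (m - 1)) + (M₁ * (M₁ - 1) - n * (n - 1))) * (c m * c n) := by
    have h1 := sum_sq_mul_invSum_mul_coeff hZ m
    have h2 := sum_sq_mul_invSum_mul_coeff hZ n
    rw [Fintype.card_fin] at h1 h2
    have : ∀ i, Z i ^ 2 * invSum Z (Z i) * -(e i m * c n + c m * e i n) =
        -(Z i ^ 2 * invSum Z (Z i) * e i m) * c n +
        -(Z i ^ 2 * invSum Z (Z i) * e i n) * c m := fun i => by ring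
    simp only [this, Finset.sum_add_distrib, ← Finset.sum_mul, Finset.sum_neg_distrib]
    linear_combination -c n * h1 - c m * h2
  have d₃ : ∑ i, Z i ^ 2 * (2 * (e i m * e i n)) = 2 * ∑ i, Z i ^ 2 * (e i m * e i n) := by
    rw [Finset.mul_sum]; exact Finset.sum_congr rfl fun i _ => by ring
  have d₄ := sum_sq_mul_coeff_mul_coeff Z m n
  simp only [Fintype.card_fin] at hsum d₄
  rw [d₁, d₂, d₃, d₄] at hsum
  rw [hR, g₁, g₂, g₃]
  linear_combination 2 * (Real.pi : ℂ) ^ 2 / (N : ℂ) ^ 2 * (hop₁ + hop₂ + ψ₀ * hsum)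

/-- The terms with `m + ℓ > M₁` vanish for degree reasons. -/
theorem sum_range_eq_sum_Icc_ellMax {M₁ m n : ℕ} {Z : Fin M₁ → ℂ} :
    ∑ l ∈ Finset.range n, ((m : ℂ) - n + 2 * (l + 1)) *
          ((rootPoly Z Finset.univ).coeff (m + (l + 1)) *
            (rootPoly Z Finset.univ).coeff (n - (l + 1))) =
      ∑ l ∈ Finset.Icc 1 (ellMax M₁ m n), ((m : ℂ) - n + 2 * l) *
          ((rootPoly Z Finset.univ).coeff (m + l) * (rootPoly Z Finset.univ).coeff (n - l)) := by
  have h1 : ∑ l ∈ Finset.range n, ((m : ℂ) - n + 2 * (l + 1)) *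
      ((rootPoly Z Finset.univ).coeff (m + (l + 1)) *
        (rootPoly Z Finset.univ).coeff (n - (l + 1))) =
      ∑ l ∈ Finset.Icc 1 n, ((m : ℂ) - n + 2 * l) *
        ((rootPoly Z Finset.univ).coeff (m + l) * (rootPoly Z Finset.univ).coeff (n - l)) := by
    rw [Finset.range_eq_Ico, show Finset.Icc 1 n = Finset.Ico (0 + 1) (n + 1) from by ext; simp,
      ← Finset.sum_Ico_add']
    exact Finset.sum_congr rfl fun l _ => by push_cast; rfl
  rw [h1]
  symm
  refine Finset.sum_subset ?_ ?_
  · intro l hl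
    simp only [ellMax, Finset.mem_Icc, le_inf_iff] at hl ⊢
    exact ⟨hl.1, hl.2.2⟩
  · intro l hl hl'
    simp only [ellMax, Finset.mem_Icc] at hl hl'
    rw [coeff_eq_zero_of_natDegree_lt (n := m + l), zero_mul, mul_zero]
    rw [natDegree_rootPoly, Finset.card_univ, Fintype.card_fin]
    omega

/-- The Hamiltonian acts triangularly on the momentum states, with diagonal entries `E_mn`. -/
theorem hamiltonian_ket_psiMomentum (hM₁ : 3 * M₁ + 4 = N) (hM₂ : 3 * M₂ = N + 2) {m n : ℕ}
    (hnm : n ≤ m) (hm : m ≤ M₁) :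
    hamiltonian N (ket N (psiMomentum N M₁ M₂ m n)) =
      (energy N M₁ m n : ℂ) • ket N (psiMomentum N M₁ M₂ m n) -
        ((4 * Real.pi ^ 2 / (N : ℝ) ^ 2 : ℝ) : ℂ) •
          ∑ ℓ ∈ Finset.Icc 1 (ellMax M₁ m n),
            ((m : ℂ) - n + 2 * ℓ) • ket N (psiMomentum N M₁ M₂ (m + ℓ) (n - ℓ)) := by
  have hM : M₁ < N := by omega
  funext c
  by_cases hc : ∃ (z : Fin M₁ → Fin N) (w : Fin M₂ → Fin N), IsPlacement z w ∧ c = config z w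
  · obtain ⟨z, w, h, rfl⟩ := hc
    rw [hamiltonian_ket_psiMomentum_config hM₁ hM₂ (by omega) (by omega) h,
      sum_range_eq_sum_Icc_ellMax]
    simp only [Pi.sub_apply, Pi.smul_apply, Finset.sum_apply, smul_eq_mul]
    have hterm : ∀ l ∈ Finset.Icc 1 (ellMax M₁ m n), ((m : ℂ) - n + 2 * l) *
        ket N (psiMomentum N M₁ M₂ (m + l) (n - l)) (config z w) =
        ((m : ℂ) - n + 2 * l) * ((rootPoly (fun i => site N (z i)) Finset.univ).coeff (m + l) *
          (rootPoly (fun i => site N (z i)) Finset.univ).coeff (n - l)) *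
          psiZero M₁ M₂ (fun i => site N (z i)) fun k => site N (w k) := by
      intro l hl
      have hl' : l ≤ M₁ - m := (Finset.mem_Icc.1 hl).2.trans (min_le_left _ _)
      rw [ket_psiMomentum_config hM (by omega) (by omega) h]
      ring
    rw [Finset.sum_congr rfl hterm, ← Finset.sum_mul,
      ket_psiMomentum_config hM (by omega) (by omega) h]
    have hN0 : (N : ℂ) ≠ 0 := by exact_mod_cast (by omega : N ≠ 0)
    have hMc : (M₁ : ℂ) = ((N : ℂ) - 4) / 3 := by
      rw [← hM₁]; push_cast; ring
    have hMc' : (M₂ : ℂ) = ((N : ℂ) + 2) / 3 := by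
      have : (3 : ℂ) * M₂ = N + 2 := by exact_mod_cast hM₂
      linear_combination (1 / 3 : ℂ) * this
    simp only [energy, pairConstant]
    push_cast
    rw [hMc, hMc']
    field_simp
    ring
  · push Not at hc
    have h0 : ∀ Ψ : WaveFunction M₁ M₂, ket N Ψ c = 0 := fun Ψ => ket_apply_eq_zero Ψ hc
    have h1 : ∀ (Ψ : WaveFunction M₁ M₂) (π : Equiv.Perm (Fin N)), ket N Ψ (c ∘ π) = 0 := by
      intro Ψ π
      refine ket_apply_eq_zero Ψ fun z w h e => ?_
      obtain ⟨h', e'⟩ := config_comp_perm h π.symm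
      refine hc _ _ h' ?_
      rw [← e', ← e]
      funext x
      simp
    rw [hamiltonian_apply]
    simp [h0, h1]

end triangular

/-! ### Linear independence of the momentum states -/

section independence

open Polynomial

theorem exists_rootPoly_eq {M : ℕ} {Q : ℂ[X]} (hQ : Q.Monic) (hd : Q.natDegree = M) :
    ∃ Z : Fin M → ℂ, rootPoly Z Finset.univ = Q := by
  induction M generalizing Q with
  | zero => exact ⟨Fin.elim0, by rw [hQ.natDegree_eq_zero.1 hd]; simp [rootPoly]⟩
  | succ M ih =>
    obtain ⟨a, ha⟩ := IsAlgClosed.exists_root Q (by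
      rw [degree_eq_natDegree hQ.ne_zero, hd]; exact_mod_cast Nat.succ_ne_zero M)
    obtain ⟨R, rfl⟩ := dvd_iff_isRoot.2 ha
    have hR : R.Monic := (monic_X_sub_C a).of_mul_monic_left hQ
    have hdR : R.natDegree = M := by
      rw [(monic_X_sub_C a).natDegree_mul hR, natDegree_X_sub_C] at hd
      omega
    obtain ⟨Z, rfl⟩ := ih hR hdR
    exact ⟨Fin.cons a Z, by simp [rootPoly, Fin.prod_univ_succ]⟩

variable {N M₁ M₂ m n : ℕ}

/-- The products `c_{m+ℓ} c_{n-ℓ}` of coefficients of monic polynomials of degree `M₁` are linearly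
independent: `X^M₁ + X^(m+ℓ) + X^(n-ℓ)` isolates the term `ℓ`. -/
theorem eq_zero_of_sum_coeff_mul_coeff_eq_zero (hnm : n ≤ m) (hm : m ≤ M₁) {b : ℕ → ℂ}
    (hb : ∀ Z : Fin M₁ → ℂ, ∑ l ∈ Finset.range (ellMax M₁ m n + 1),
      b l * ((rootPoly Z Finset.univ).coeff (m + l) * (rootPoly Z Finset.univ).coeff (n - l)) = 0)
    {l : ℕ} (hl : l ≤ ellMax M₁ m n) : b l = 0 := by
  have hlim : ∀ {k}, k ≤ ellMax M₁ m n → k ≤ M₁ - m ∧ k ≤ n := fun h => le_inf_iff.1 h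
  obtain ⟨hl1, hl2⟩ := hlim hl
  set T : Finset ℕ := {M₁, m + l, n - l} with hT
  have hMT : M₁ ∈ T := by simp [hT]
  set Q : ℂ[X] := ∑ j ∈ T, X ^ j with hQ
  have hQ' : Q = X ^ M₁ + ∑ j ∈ T.erase M₁, X ^ j := (Finset.add_sum_erase T _ hMT).symm
  have hlow : (∑ j ∈ T.erase M₁, (X : ℂ[X]) ^ j).degree < M₁ := by
    refine (degree_sum_le _ _).trans_lt
      ((Finset.sup_lt_iff (WithBot.bot_lt_coe _)).2 fun j hj => ?_)
    rw [degree_X_pow]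
    have h1 := Finset.ne_of_mem_erase hj
    have h2 := Finset.mem_of_mem_erase hj
    simp only [hT, Finset.mem_insert, Finset.mem_singleton] at h2
    exact_mod_cast (by omega : j < M₁)
  have hmonic : Q.Monic := by rw [hQ']; exact monic_X_pow_add hlow
  have hdeg : Q.natDegree = M₁ := by
    rw [hQ', natDegree_eq_of_degree_eq_some]
    rw [degree_add_eq_left_of_degree_lt (by rwa [degree_X_pow]), degree_X_pow]
  obtain ⟨Z, hZ⟩ := exists_rootPoly_eq hmonic hdeg
  have hcoeff : ∀ j, Q.coeff j = if j ∈ T then 1 else 0 := by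
    intro j
    simp [hQ, finsetSum_coeff, coeff_X_pow]
  have h := hb Z
  rw [hZ, Finset.sum_eq_single l] at h
  · rw [hcoeff, hcoeff, if_pos (by simp [hT]), if_pos (by simp [hT])] at h
    simpa using h
  · intro k hk hkl
    obtain ⟨hk1, hk2⟩ := hlim (Nat.lt_succ_iff.1 (Finset.mem_range.1 hk))
    rw [hcoeff, hcoeff]
    split_ifs with h1 h2
    · simp only [hT, Finset.mem_insert, Finset.mem_singleton] at h1 h2
      omega
    · simp
    · simp
    · simp
  · intro hh
    exact absurd (Finset.mem_range.2 (Nat.lt_succ_of_le hl)) hh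

/-- The combinations are quadratic in each coordinate, so that their vanishing when the coordinates
are restricted to disjoint triples of sites implies their vanishing everywhere. -/
theorem sum_coeff_mul_coeff_eq_zero_of_forall_site (s : Finset ℕ) (b : ℕ → ℂ) (p q : ℕ → ℕ)
    (S : Fin M₁ → Finset ℂ) (hS : ∀ i, (S i).card = 3)
    (hb : ∀ Z : Fin M₁ → ℂ, (∀ i, Z i ∈ S i) → ∑ l ∈ s,
      b l * ((rootPoly Z Finset.univ).coeff (p l) * (rootPoly Z Finset.univ).coeff (q l)) = 0)
    (Z : Fin M₁ → ℂ) :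
    ∑ l ∈ s,
      b l * ((rootPoly Z Finset.univ).coeff (p l) * (rootPoly Z Finset.univ).coeff (q l)) = 0 := by
  have key : ∀ t : Finset (Fin M₁), ∀ Z : Fin M₁ → ℂ, (∀ i, i ∉ t → Z i ∈ S i) → ∑ l ∈ s,
      b l * ((rootPoly Z Finset.univ).coeff (p l) *
        (rootPoly Z Finset.univ).coeff (q l)) = 0 := by
    intro t
    induction t using Finset.induction_on with
    | empty => exact fun Z hZ => hb Z fun i => hZ i (by simp)
    | insert a t _ ih =>
      intro Z hZ
      set P : ℂ[X] := ∑ l ∈ s, C (b l) * coeffPoly Z (p l) (q l) a with hP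
      have hPeval : ∀ y, P.eval y = ∑ l ∈ s,
          b l * ((rootPoly (Function.update Z a y) Finset.univ).coeff (p l) *
            (rootPoly (Function.update Z a y) Finset.univ).coeff (q l)) := by
        intro y
        simp [hP, eval_finsetSum, eval_coeffPoly]
      have hPdeg : P.natDegree ≤ 2 :=
        natDegree_sum_le_of_forall_le _ _ fun l _ =>
          (natDegree_C_mul_le _ _).trans (natDegree_coeffPoly_le _ _ _ _)
      have hP0 : P = 0 := by
        refine eq_zero_of_natDegree_lt_card_of_eval_eq_zero' P (S a) (fun y hy => ?_)
          (by rw [hS]; omega)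
        rw [hPeval]
        refine ih _ fun i hi => ?_
        by_cases hia : i = a
        · subst hia; simpa using hy
        · rw [Function.update_of_ne hia]
          exact hZ i (by simp [hia, hi])
      have := hPeval (Z a)
      rwa [hP0, eval_zero, Function.update_eq_self, eq_comm] at this
  exact key Finset.univ Z (by simp)

theorem exists_isPlacement {z : Fin M₁ → Fin N} (hz : Function.Injective z) (h : M₁ + M₂ ≤ N) :
    ∃ w : Fin M₂ → Fin N, IsPlacement z w := by
  have hcard : M₂ ≤ (Finset.univ \ Finset.univ.image z).card := by
    rw [Finset.card_sdiff_of_subset (Finset.subset_univ _), Finset.card_image_of_injective _ hz]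
    simp
    omega
  refine ⟨Finset.orderEmbOfCardLe _ hcard, hz, (Finset.orderEmbOfCardLe _ hcard).injective,
    fun i k e => ?_⟩
  have := Finset.orderEmbOfCardLe_mem _ hcard k
  rw [← e] at this
  simp at this

/-- The momentum states `Ψ_{m+ℓ,n-ℓ}` are linearly independent. Three sites for each of the `M₁`
blue particles are available because `3 M₁ ≤ N`. -/
theorem eq_zero_of_sum_smul_ket_psiMomentum_eq_zero (hM₁ : 3 * M₁ + 4 = N) (hM₂ : 3 * M₂ = N + 2)
    (hnm : n ≤ m) (hm : m ≤ M₁) {b : ℕ → ℂ}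
    (hb : ∑ l ∈ Finset.range (ellMax M₁ m n + 1),
      b l • ket N (psiMomentum N M₁ M₂ (m + l) (n - l)) = 0)
    {l : ℕ} (hl : l ≤ ellMax M₁ m n) : b l = 0 := by
  have hM : M₁ < N := by omega
  refine eq_zero_of_sum_coeff_mul_coeff_eq_zero hnm hm (b := b) ?_ hl
  have hlt : ∀ (i : Fin M₁) (r : Fin 3), 3 * (i : ℕ) + r < N := fun i r => by omega
  refine sum_coeff_mul_coeff_eq_zero_of_forall_site _ b (fun l => m + l) (fun l => n - l)
    (fun i => Finset.univ.image fun r : Fin 3 => site N ⟨3 * i + r, hlt i r⟩) ?_ ?_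
  · intro i
    rw [Finset.card_image_of_injective]
    · simp
    · intro r r' e
      have := congrArg Fin.val (site_injective e)
      simp only at this
      exact Fin.ext (by omega)
  · intro Z hZ
    simp only [Finset.mem_image, Finset.mem_univ, true_and] at hZ
    choose r hr using hZ
    set z : Fin M₁ → Fin N := fun i => ⟨3 * i + r i, hlt i (r i)⟩ with hz
    have hzinj : Function.Injective z := by
      intro i j e
      have := congrArg Fin.val e
      simp only [hz] at this
      exact Fin.ext (by omega)
    obtain ⟨w, hw⟩ := exists_isPlacement (M₂ := M₂) hzinj (by omega)
    have hZz : Z = fun i => site N (z i) := funext fun i => (hr i).symm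
    have h0 : psiZero M₁ M₂ (fun i => site N (z i)) (fun k => site N (w k)) ≠ 0 :=
      psiZero_ne_zero (site_injective.comp hw.inj_left) (site_injective.comp hw.inj_right)
        (fun i k e => hw.disj i k (site_injective e)) (fun _ => site_ne_zero _)
        fun _ => site_ne_zero _
    have h1 := congrFun hb (config z w)
    rw [Finset.sum_apply, Pi.zero_apply] at h1
    refine (mul_eq_zero.1 (?_ : _ * psiZero M₁ M₂ (fun i => site N (z i))
      (fun k => site N (w k)) = 0)).resolve_right h0
    rw [← h1, Finset.sum_mul]
    refine Finset.sum_congr rfl fun k hk => ?_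
    have hk' : k ≤ M₁ - m :=
      (Nat.lt_succ_iff.1 (Finset.mem_range.1 hk)).trans (min_le_left _ _)
    rw [Pi.smul_apply, smul_eq_mul, ket_psiMomentum_config hM (by omega) (by omega) hw, hZz]
    ring

end independence

/-! ### The eigenvalue equation -/

section eigen

variable {N M₁ M₂ m n : ℕ}

theorem ket_psiCombination (a : ℕ → ℂ) :
    ket N (psiCombination N M₁ M₂ m n a) = ∑ l ∈ Finset.range (ellMax M₁ m n + 1),
      a l • ket N (psiMomentum N M₁ M₂ (m + l) (n - l)) :=
  ket_sum _ _ fun l => psiMomentum N M₁ M₂ (m + l) (n - l)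

/-- The coefficient of `Ψ_{m+ℓ,n-ℓ}` collects the off-diagonal terms of all `Ψ_{m+j,n-j}`, `j < ℓ`;
their strength `m - n + 2ℓ` depends on the target only. -/
theorem hamiltonian_ket_psiCombination (hM₁ : 3 * M₁ + 4 = N) (hM₂ : 3 * M₂ = N + 2)
    (hnm : n ≤ m) (hm : m ≤ M₁) (a : ℕ → ℂ) :
    hamiltonian N (ket N (psiCombination N M₁ M₂ m n a)) =
      ∑ l ∈ Finset.range (ellMax M₁ m n + 1),
        ((energy N M₁ (m + l) (n - l) : ℂ) * a l -
          4 * (Real.pi : ℂ) ^ 2 / (N : ℂ) ^ 2 * ((m : ℂ) - n + 2 * l) *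
            ∑ j ∈ Finset.range l, a j) •
          ket N (psiMomentum N M₁ M₂ (m + l) (n - l)) := by
  set v : ℕ → State N := fun l => ket N (psiMomentum N M₁ M₂ (m + l) (n - l)) with hv
  set L := ellMax M₁ m n with hL
  set κ : ℂ := 4 * (Real.pi : ℂ) ^ 2 / (N : ℂ) ^ 2 with hκ
  have h1 : ∀ l ∈ Finset.range (L + 1), hamiltonian N (v l) =
      (energy N M₁ (m + l) (n - l) : ℂ) • v l -
        κ • ∑ k ∈ Finset.Ioc l L, ((m : ℂ) - n + 2 * k) • v k := by
    intro l hl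
    have hl' : l ≤ M₁ - m ∧ l ≤ n :=
      le_inf_iff.1 (Nat.lt_succ_iff.1 (Finset.mem_range.1 hl) : l ≤ min (M₁ - m) n)
    have hL' : ellMax M₁ (m + l) (n - l) = L - l := by
      simp only [hL, ellMax]; omega
    have hll : l ≤ L := Nat.lt_succ_iff.1 (Finset.mem_range.1 hl)
    rw [hv]
    simp only
    rw [hamiltonian_ket_psiMomentum hM₁ hM₂ (m := m + l) (n := n - l) (by omega) (by omega), hL']
    have e1 : ((4 * Real.pi ^ 2 / (N : ℝ) ^ 2 : ℝ) : ℂ) = κ := by rw [hκ]; push_cast; rfl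
    have e2 : Finset.Ioc l L = (Finset.Icc 1 (L - l)).image (fun k => l + k) := by
      rw [Finset.image_add_left_Icc]
      ext x
      simp only [Finset.mem_Ioc, Finset.mem_Icc]
      omega
    rw [e1, e2, Finset.sum_image (by intro x _ y _; simp)]
    congr 2
    refine Finset.sum_congr rfl fun k _ => ?_
    rw [show m + l + k = m + (l + k) by ring, show n - l - k = n - (l + k) by omega,
      Nat.cast_sub hl'.2]
    congr 1
    push_cast
    ring
  rw [ket_psiCombination, map_sum]
  have h2 : ∀ l ∈ Finset.range (L + 1), hamiltonian N (a l • v l) =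
      ((energy N M₁ (m + l) (n - l) : ℂ) * a l) • v l -
        ∑ k ∈ Finset.Ioc l L, (κ * ((m : ℂ) - n + 2 * k) * a l) • v k := by
    intro l hl
    rw [map_smul, h1 l hl, smul_sub, smul_smul, mul_comm, smul_smul, Finset.smul_sum]
    congr 1
    refine Finset.sum_congr rfl fun k _ => ?_
    rw [smul_smul]
    congr 1
    ring
  rw [Finset.sum_congr rfl h2, Finset.sum_sub_distrib]
  simp only [sub_smul, Finset.sum_sub_distrib, Finset.mul_sum, Finset.sum_smul]
  congr 1
  refine Finset.sum_comm' fun l k => ?_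
  simp only [Finset.mem_range, Finset.mem_Ioc]
  omega

theorem energy_sub_energy {l : ℕ} (h : l ≤ n) :
    energy N M₁ m n - energy N M₁ (m + l) (n - l) =
      6 * Real.pi ^ 2 / (N : ℝ) ^ 2 * (l * ((m : ℝ) - n + l + 2 / 3)) := by
  simp only [energy, Nat.cast_sub h]
  push_cast
  ring

/-- The partial sums of the `a_ℓ^{mn}` are multiples of the last term, which turns the triangular
eigenvalue equation into a two-term recursion. -/
theorem coeff_succ_mul (hnm : n ≤ m) (l : ℕ) :
    3 * (((l : ℝ) + 1) * ((m : ℝ) - n + l + 5 / 3)) * coeff m n (l + 1) =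
      -2 * ((m : ℝ) - n + 2 * (l + 1)) * ∑ j ∈ Finset.range (l + 1), coeff m n j := by
  have hd : (0 : ℝ) ≤ (m : ℝ) - n := sub_nonneg.2 (by exact_mod_cast hnm)
  have hrec : ∀ l : ℕ, ((m : ℝ) - n + 2 * l) * ∑ j ∈ Finset.range (l + 1), coeff m n j =
      coeff m n l * (((m : ℝ) - n + l) * (1 - 3 / 2 * l)) →
      3 * (((l : ℝ) + 1) * ((m : ℝ) - n + l + 5 / 3)) * coeff m n (l + 1) =
      -2 * ((m : ℝ) - n + 2 * (l + 1)) * ∑ j ∈ Finset.range (l + 1), coeff m n j := by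
    intro l hS
    by_cases h0 : m = n ∧ l = 0
    · obtain ⟨rfl, rfl⟩ := h0
      simp [coeff]
      norm_num
    · have hpos : (0 : ℝ) < (m : ℝ) - n + 2 * l := by
        rcases Nat.eq_zero_or_pos l with hl | hl
        · have : n < m := lt_of_le_of_ne hnm fun e => h0 ⟨e.symm, hl⟩
          have : (0 : ℝ) < (m : ℝ) - n := sub_pos.2 (by exact_mod_cast this)
          positivity
        · have : (0 : ℝ) < l := by exact_mod_cast hl
          positivity
      have hpos2 : (0 : ℝ) < (m : ℝ) - n + l + 5 / 3 := by positivity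
      have hcoef : coeff m n (l + 1) = ((l : ℝ) - 2 / 3) * ((m : ℝ) - n + l) *
          ((m : ℝ) - n + 2 * (l + 1)) /
          (((l : ℝ) + 1) * ((m : ℝ) - n + l + 5 / 3) * ((m : ℝ) - n + 2 * l)) * coeff m n l := by
        rw [coeff, if_neg (by simpa using h0)]
        push_cast
        congr 2 <;> ring
      have hS' : ∑ j ∈ Finset.range (l + 1), coeff m n j =
          coeff m n l * (((m : ℝ) - n + l) * (1 - 3 / 2 * l)) / ((m : ℝ) - n + 2 * l) := by
        rw [← hS]; field_simp
      have hl1 : (l : ℝ) + 1 ≠ 0 := by positivity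
      have hp := hpos.ne'
      have hp2 := hpos2.ne'
      rw [hS', hcoef]
      generalize (m : ℝ) - n + 2 * l = A at hp ⊢
      generalize (m : ℝ) - n + l + 5 / 3 = B at hp2 ⊢
      field_simp
      ring
  have hsum : ∀ l : ℕ, ((m : ℝ) - n + 2 * l) * ∑ j ∈ Finset.range (l + 1), coeff m n j =
      coeff m n l * (((m : ℝ) - n + l) * (1 - 3 / 2 * l)) := by
    intro l
    induction l with
    | zero => simp [coeff]
    | succ l ih =>
      have h1 := hrec l ih
      rw [Finset.sum_range_succ]
      push_cast
      linear_combination (1 / 2 : ℝ) * h1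
  exact hrec l (hsum l)

/-- The eigenvalue equation of an Ansatz, read off coefficient by coefficient. -/
theorem hamiltonian_ket_psiCombination_eq_iff (hM₁ : 3 * M₁ + 4 = N) (hM₂ : 3 * M₂ = N + 2)
    (hnm : n ≤ m) (hm : m ≤ M₁) (a : ℕ → ℂ) (E : ℂ) :
    hamiltonian N (ket N (psiCombination N M₁ M₂ m n a)) =
        E • ket N (psiCombination N M₁ M₂ m n a) ↔
      ∀ l ≤ ellMax M₁ m n, (energy N M₁ (m + l) (n - l) : ℂ) * a l -
          4 * (Real.pi : ℂ) ^ 2 / (N : ℂ) ^ 2 * ((m : ℂ) - n + 2 * l) *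
            ∑ j ∈ Finset.range l, a j = E * a l := by
  rw [hamiltonian_ket_psiCombination hM₁ hM₂ hnm hm, ket_psiCombination, Finset.smul_sum,
    ← sub_eq_zero, ← Finset.sum_sub_distrib]
  simp only [smul_smul, ← sub_smul]
  constructor
  · intro h l hl
    exact sub_eq_zero.1 (eq_zero_of_sum_smul_ket_psiMomentum_eq_zero hM₁ hM₂ hnm hm h hl)
  · intro h
    refine Finset.sum_eq_zero fun l hl => ?_
    rw [h l (Nat.lt_succ_iff.1 (Finset.mem_range.1 hl)), sub_self, zero_smul]

/-- For the energy `E_mn` the coefficientwise eigenvalue equation determines `a_ℓ` by the preceding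
coefficients. -/
theorem energy_mul_sub_eq_iff (hN : 0 < N) (hnm : n ≤ m) (a : ℕ → ℂ) {l : ℕ} (hl : l + 1 ≤ n)
    (ha : ∀ j ≤ l, a j = (coeff m n j : ℂ)) :
    (energy N M₁ (m + (l + 1)) (n - (l + 1)) : ℂ) * a (l + 1) -
        4 * (Real.pi : ℂ) ^ 2 / (N : ℂ) ^ 2 * ((m : ℂ) - n + 2 * ((l + 1 : ℕ) : ℂ)) *
          ∑ j ∈ Finset.range (l + 1), a j = (energy N M₁ m n : ℂ) * a (l + 1) ↔
      a (l + 1) = (coeff m n (l + 1) : ℂ) := by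
  have hE : (energy N M₁ m n : ℂ) - (energy N M₁ (m + (l + 1)) (n - (l + 1)) : ℂ) =
      6 * (Real.pi : ℂ) ^ 2 / (N : ℂ) ^ 2 * (((l : ℂ) + 1) * ((m : ℂ) - n + l + 5 / 3)) := by
    have := energy_sub_energy (N := N) (M₁ := M₁) (m := m) hl
    rw [← Complex.ofReal_sub, this]
    push_cast
    ring
  have hsum : ∑ j ∈ Finset.range (l + 1), a j =
      ((∑ j ∈ Finset.range (l + 1), coeff m n j : ℝ) : ℂ) := by
    rw [Complex.ofReal_sum]
    exact Finset.sum_congr rfl fun j hj => ha j (Nat.lt_succ_iff.1 (Finset.mem_range.1 hj))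
  have hrec : 3 * (((l : ℂ) + 1) * ((m : ℂ) - n + l + 5 / 3)) * (coeff m n (l + 1) : ℂ) =
      -2 * ((m : ℂ) - n + 2 * (l + 1)) *
        ((∑ j ∈ Finset.range (l + 1), coeff m n j : ℝ) : ℂ) := by
    have := congrArg Complex.ofReal (coeff_succ_mul hnm l)
    push_cast at this ⊢
    linear_combination this
  have hpos : 6 * (Real.pi : ℂ) ^ 2 / (N : ℂ) ^ 2 *
      (((l : ℂ) + 1) * ((m : ℂ) - n + l + 5 / 3)) ≠ 0 := by
    have hd : (0 : ℝ) ≤ (m : ℝ) - n := sub_nonneg.2 (by exact_mod_cast hnm)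
    have hN' : (0 : ℝ) < N := by exact_mod_cast hN
    have hr : (0 : ℝ) < 6 * Real.pi ^ 2 / (N : ℝ) ^ 2 *
        (((l : ℝ) + 1) * ((m : ℝ) - n + l + 5 / 3)) := by
      have := Real.pi_pos
      have : (0 : ℝ) < (m : ℝ) - n + l + 5 / 3 := by positivity
      positivity
    have h := Complex.ofReal_ne_zero.2 hr.ne'
    push_cast at h
    exact h
  rw [hsum]
  push_cast at hrec ⊢
  constructor
  · intro h
    refine mul_left_cancel₀ hpos ?_
    linear_combination -h - a (l + 1) * hE - 2 * (Real.pi : ℂ) ^ 2 / (N : ℂ) ^ 2 * hrec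
  · intro h
    rw [h]
    linear_combination -(coeff m n (l + 1) : ℂ) * hE - 2 * (Real.pi : ℂ) ^ 2 / (N : ℂ) ^ 2 * hrec

end eigen

end HaldaneShastry

theorem mainTheorem2 (N M M₁ M₂ : ℕ) (hN : N + 2 = 3 * M)
    (hM₁ : 3 * M₁ + 4 = N) (hM₂ : 3 * M₂ = N + 2)
    (m n : ℕ) (hnm : n ≤ m) (hm : m ≤ M₁) :
    -- the Hamiltonian acts triangularly on the momentum states
    (hamiltonian N (ket N (psiMomentum N M₁ M₂ m n)) =
      ((-(Real.pi ^ 2 / 18) * ((N : ℝ) - 17 / N + 52 / (N : ℝ) ^ 2) : ℝ) : ℂ) •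
          ket N (psiMomentum N M₁ M₂ m n) +
        ((3 * Real.pi ^ 2 / (N : ℝ) ^ 2 *
            (((M₁ : ℝ) - m) * m + ((M₁ : ℝ) - n) * n - 2 / 3 * ((m : ℝ) - n)) : ℝ) : ℂ) •
          ket N (psiMomentum N M₁ M₂ m n) -
        ((4 * Real.pi ^ 2 / (N : ℝ) ^ 2 : ℝ) : ℂ) •
          ∑ ℓ ∈ Finset.Icc 1 (ellMax M₁ m n),
            ((m : ℂ) - n + 2 * ℓ) • ket N (psiMomentum N M₁ M₂ (m + ℓ) (n - ℓ))) ∧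
    -- the states `Φ_mn` are (nonzero) eigenstates with energy `E_mn`
    Module.End.HasEigenvector (hamiltonian N) (energy N M₁ m n : ℂ) (ket N (phi N M₁ M₂ m n)) ∧
    -- the eigenvalue equation for the Ansatz forces the recursion and the energy
    (∀ (a : ℕ → ℂ) (E : ℂ), a 0 = 1 →
      hamiltonian N (ket N (psiCombination N M₁ M₂ m n a)) =
        E • ket N (psiCombination N M₁ M₂ m n a) →
      E = (energy N M₁ m n : ℂ) ∧ ∀ ℓ ≤ ellMax M₁ m n, a ℓ = (coeff m n ℓ : ℂ)) ∧
    -- the energy is that of two free colorons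
    energy N M₁ m n =
      energyZero N + 4 / 9 * Real.pi ^ 2 / (N : ℝ) ^ 2 +
        dispersion (momentumM N m) + dispersion (momentumN N n) ∧
    -- the spacing of the single-coloron momenta is `(2π/N)(2/3 + integer)`
    momentumN N n - momentumM N m =
      2 * Real.pi / N * (2 / 3 + (((m : ℤ) - (n : ℤ) : ℤ) : ℝ)) := by
  have hN0 : 0 < N := by omega
  have hNr : (N : ℝ) ≠ 0 := by exact_mod_cast hN0.ne'
  have hlim : ∀ {l}, l ≤ ellMax M₁ m n → l ≤ n := fun h => h.trans (min_le_right _ _)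
  refine ⟨?_, ?_, ?_, ?_, ?_⟩
  · rw [hamiltonian_ket_psiMomentum hM₁ hM₂ hnm hm, ← add_smul, ← Complex.ofReal_add]
    rfl
  · rw [Module.End.hasEigenvector_iff, Module.End.mem_eigenspace_iff]
    constructor
    · refine (hamiltonian_ket_psiCombination_eq_iff hM₁ hM₂ hnm hm _ _).2 fun l hl => ?_
      rcases l with _ | l
      · simp
      · exact (energy_mul_sub_eq_iff hN0 hnm _ (hlim hl) fun _ _ => rfl).2 rfl
    · intro h0
      rw [phi, ket_psiCombination] at h0
      have := eq_zero_of_sum_smul_ket_psiMomentum_eq_zero hM₁ hM₂ hnm hm h0 (Nat.zero_le _)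
      simp [coeff] at this
  · intro a E ha0 h
    rw [hamiltonian_ket_psiCombination_eq_iff hM₁ hM₂ hnm hm] at h
    have hE : E = (energy N M₁ m n : ℂ) := by
      have := h 0 (Nat.zero_le _)
      simp only [ha0, Finset.range_zero, Finset.sum_empty] at this
      simpa using this.symm
    subst hE
    refine ⟨rfl, fun l => ?_⟩
    induction l using Nat.strong_induction_on with
    | _ l ih =>
      intro hl
      rcases l with _ | l
      · simp [ha0, coeff]
      · exact (energy_mul_sub_eq_iff hN0 hnm a (hlim hl)
          fun j hj => ih j (by omega) (by omega)).1 (h (l + 1) hl)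
  · have hMr : (M₁ : ℝ) = ((N : ℝ) - 4) / 3 := by
      rw [← hM₁]; push_cast; ring
    simp only [energy, energyZero, dispersion, momentumM, momentumN, hMr]
    field_simp
    ring
  · simp only [momentumM, momentumN]
    push_cast
    ring
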